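/- Let $k$ be an algebraically closed field of arbitrary characteristic and let $H$ be a finite-dimensional Hopf algebra over $k$ with comultiplication $\Delta$, counit $\varepsilon$ and antipode $S$. A \emph{twist} for $H$ is an invertible element $J\in H\otimes H$ such that $$(\Delta\otimes\mathrm{id})(J)\,(J\otimes 1)=(\mathrm{id}\otimes\Delta)(J)\,(1\otimes J),\qquad (\varepsilon\otimes\mathrm{id})(J)=(\mathrm{id}\otimes\varepsilon)(J)=1 .$$ Write $J=\sum J^{(1)}\otimes J^{(2)}$ and put $Q_J=\sum S(J^{(1)})J^{(2)}$, which is an invertible element of $H$, and $u_J=Q_J^{-1}S(Q_J)$. Let $H^J$ be the Hopf algebra with the same algebra structure and counit as $H$, with comultiplication $\Delta^J(h)=J^{-1}\Delta(h)J$ and antipode $S^J(h)=Q_J^{-1}S(h)Q_J$. Suppose that $H$ is cosemisimple (that is, $H$ is the sum of its simple subcoalgebras) and involutive (that is, $S^2=\mathrm{id}$), and let $J$ be a twist for $H$. Then $u_J=1$, equivalently $S(Q_J)=Q_J$. Moreover $H^J$ is again finite-dimensional, cosemisimple and involutive, i.e. $(S^J)^2=\mathrm{id}$. Thus, in any characteristic,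 the class of finite-dimensional cosemisimple involutive Hopf algebras over $k$ is closed under twisting. -/

import Mathlib

open scoped TensorProduct

/-! ### Cosemisimple coalgebras -/

section Cosemisimple

variable (k : Type*) {C : Type*} [Field k] [AddCommGroup C] [Module k C] [Coalgebra k C]

/-- A subspace `D` of a coalgebra `C` is a subcoalgebra if `Δ(D) ⊆ D ⊗ D`, the latter being
viewed inside `C ⊗ C`. -/
def IsSubcoalgebra (D : Submodule k C) : Prop :=
  ∀ x ∈ D, Coalgebra.comul (R := k) x ∈ LinearMap.range (TensorProduct.map D.subtype D.subtype)

/-- A simple subcoalgebra: a nonzero subcoalgebra having no subcoalgebras but `0` and itself. -/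
def IsSimpleSubcoalgebra (D : Submodule k C) : Prop :=
  IsSubcoalgebra k D ∧ D ≠ ⊥ ∧ ∀ E : Submodule k C, IsSubcoalgebra k E → E ≤ D → E = ⊥ ∨ E = D

variable (C) in
/-- A coalgebra is cosemisimple if it is the sum of its simple subcoalgebras. -/
def IsCosemisimple : Prop :=
  sSup {D : Submodule k C | IsSimpleSubcoalgebra k D} = ⊤

end Cosemisimple

/-- A Hopf algebra is involutive if the square of its antipode is the identity. -/
def IsInvolutiveHopf (k H : Type*) [Field k] [Ring H] [HopfAlgebra k H] : Prop :=
  HopfAlgebra.antipode k (A := H) ∘ₗ HopfAlgebra.antipode k (A := H) = LinearMap.id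

/-! ### Twists -/

namespace HopfTwist

section Maps

variable (k H : Type*) [Field k] [Ring H] [HopfAlgebra k H]

/-- `Δ ⊗ id`, with values in `H ⊗ (H ⊗ H)`. -/
noncomputable def comulLeft : H ⊗[k] H →ₐ[k] H ⊗[k] (H ⊗[k] H) :=
  (Algebra.TensorProduct.assoc k k k H H H).toAlgHom.comp
    (Algebra.TensorProduct.map (Bialgebra.comulAlgHom k H) (AlgHom.id k H))

/-- `id ⊗ Δ`. -/
noncomputable def comulRight : H ⊗[k] H →ₐ[k] H ⊗[k] (H ⊗[k] H) :=
  Algebra.TensorProduct.map (AlgHom.id k H) (Bialgebra.comulAlgHom k H)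

/-- `X ↦ X ⊗ 1`, with values in `H ⊗ (H ⊗ H)`. -/
noncomputable def inclLeft : H ⊗[k] H →ₐ[k] H ⊗[k] (H ⊗[k] H) :=
  (Algebra.TensorProduct.assoc k k k H H H).toAlgHom.comp
    (Algebra.TensorProduct.includeLeft (R := k) (S := k) (A := H ⊗[k] H) (B := H))

/-- `X ↦ 1 ⊗ X`. -/
noncomputable def inclRight : H ⊗[k] H →ₐ[k] H ⊗[k] (H ⊗[k] H) :=
  Algebra.TensorProduct.includeRight

/-- `ε ⊗ id`, with values in `k ⊗ H = H`. -/
noncomputable def counitLeft : H ⊗[k] H →ₐ[k] H :=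
  (Algebra.TensorProduct.lid k H).toAlgHom.comp
    (Algebra.TensorProduct.map (Bialgebra.counitAlgHom k H) (AlgHom.id k H))

/-- `id ⊗ ε`, with values in `H ⊗ k = H`. -/
noncomputable def counitRight : H ⊗[k] H →ₐ[k] H :=
  (Algebra.TensorProduct.rid k k H).toAlgHom.comp
    (Algebra.TensorProduct.map (AlgHom.id k H) (Bialgebra.counitAlgHom k H))

end Maps

end HopfTwist

/-- A (normalized) twist for a Hopf algebra `H`: an invertible `J ∈ H ⊗ H` such that
`(Δ ⊗ id)(J) (J ⊗ 1) = (id ⊗ Δ)(J) (1 ⊗ J)` and `(ε ⊗ id)(J) = (id ⊗ ε)(J) = 1`. -/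
structure HopfTwist (k H : Type*) [Field k] [Ring H] [HopfAlgebra k H] where
  /-- the invertible element `J` -/
  unit : (H ⊗[k] H)ˣ
  twist_eq : HopfTwist.comulLeft k H unit * HopfTwist.inclLeft k H unit =
    HopfTwist.comulRight k H unit * HopfTwist.inclRight k H unit
  counitLeft_eq : HopfTwist.counitLeft k H unit = 1
  counitRight_eq : HopfTwist.counitRight k H unit = 1

namespace HopfTwist

section Elements

variable (k H : Type*) [Field k] [Ring H] [HopfAlgebra k H]

/-- `x ⊗ y ↦ S(x) y`. -/
noncomputable def antipodeMul : H ⊗[k] H →ₗ[k] H :=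
  LinearMap.mul' k H ∘ₗ (HopfAlgebra.antipode k (A := H)).rTensor H

/-- `x ⊗ y ↦ x S(y)`. -/
noncomputable def mulAntipode : H ⊗[k] H →ₗ[k] H :=
  LinearMap.mul' k H ∘ₗ (HopfAlgebra.antipode k (A := H)).lTensor H

/-- `x ⊗ y ⊗ z ↦ S(x) y S(z)`. -/
noncomputable def theta : H ⊗[k] (H ⊗[k] H) →ₗ[k] H :=
  LinearMap.mul' k H ∘ₗ TensorProduct.map (HopfAlgebra.antipode k (A := H)) (mulAntipode k H)

/-- `x ⊗ y ⊗ z ↦ x S(y) z`. -/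
noncomputable def omega : H ⊗[k] (H ⊗[k] H) →ₗ[k] H :=
  LinearMap.mul' k H ∘ₗ (antipodeMul k H).lTensor H

variable {k H}

@[simp] lemma antipodeMul_tmul (x y : H) :
    antipodeMul k H (x ⊗ₜ y) = HopfAlgebra.antipode k x * y := rfl

@[simp] lemma mulAntipode_tmul (x y : H) :
    mulAntipode k H (x ⊗ₜ y) = x * HopfAlgebra.antipode k y := rfl

@[simp] lemma theta_tmul (x : H) (y : H ⊗[k] H) :
    theta k H (x ⊗ₜ y) = HopfAlgebra.antipode k x * mulAntipode k H y := rfl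

@[simp] lemma omega_tmul (x : H) (y : H ⊗[k] H) :
    omega k H (x ⊗ₜ y) = x * antipodeMul k H y := rfl

@[simp] lemma counitLeft_tmul (x y : H) :
    counitLeft k H (x ⊗ₜ y) = Coalgebra.counit (R := k) x • y := rfl

@[simp] lemma counitRight_tmul (x y : H) :
    counitRight k H (x ⊗ₜ y) = Coalgebra.counit (R := k) y • x := rfl

lemma comulLeft_tmul (x y : H) : comulLeft k H (x ⊗ₜ y) =
    Algebra.TensorProduct.assoc k k k H H H (Coalgebra.comul (R := k) x ⊗ₜ y) := rfl

lemma comulRight_tmul (x y : H) : comulRight k H (x ⊗ₜ y) =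
    x ⊗ₜ Coalgebra.comul (R := k) y := rfl

lemma inclLeft_tmul (x y : H) : inclLeft k H (x ⊗ₜ y) = x ⊗ₜ (y ⊗ₜ 1) := rfl

lemma inclRight_apply (x : H ⊗[k] H) : inclRight k H x = 1 ⊗ₜ x := rfl

lemma antipodeMul_comul (x : H) : antipodeMul k H (Coalgebra.comul (R := k) x) =
    algebraMap k H (Coalgebra.counit x) :=
  HopfAlgebra.mul_antipode_rTensor_comul_apply x

lemma mulAntipode_comul (x : H) : mulAntipode k H (Coalgebra.comul (R := k) x) =
    algebraMap k H (Coalgebra.counit x) :=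
  HopfAlgebra.mul_antipode_lTensor_comul_apply x

lemma theta_comulLeft_mul (t : H ⊗[k] H) (w : H ⊗[k] (H ⊗[k] H)) :
    theta k H (comulLeft k H t * w) =
      theta k H w * HopfAlgebra.antipode k (counitLeft k H t) := by
  have key : ∀ (X : H ⊗[k] H) (b u v z : H),
      theta k H (Algebra.TensorProduct.assoc k k k H H H (X ⊗ₜ b) * (u ⊗ₜ (v ⊗ₜ z))) =
      HopfAlgebra.antipode k u * (antipodeMul k H X * (v * (HopfAlgebra.antipode k z *
        HopfAlgebra.antipode k b))) := by
    intro X b u v z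
    induction X with
    | zero => simp
    | add X Y hX hY => simp only [TensorProduct.add_tmul, map_add, add_mul, mul_add, hX, hY]
    | tmul x y => simp [HopfAlgebra.antipode_mul_antidistrib, mul_assoc]
  induction t with
  | zero => simp
  | add s t hs ht => simp only [map_add, add_mul, mul_add, hs, ht]
  | tmul a b =>
    induction w with
    | zero => simp
    | add s t hs ht => simp only [map_add, add_mul, mul_add, hs, ht]
    | tmul u w =>
      induction w with
      | zero => simp
      | add s t hs ht => simp only [TensorProduct.tmul_add, map_add, add_mul, mul_add, hs, ht]
      | tmul v z =>
        rw [comulLeft_tmul, key, antipodeMul_comul]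
        simp [Algebra.algebraMap_eq_smul_one, mul_assoc]

lemma theta_comulRight (t : H ⊗[k] H) :
    theta k H (comulRight k H t) = HopfAlgebra.antipode k (counitRight k H t) := by
  induction t with
  | zero => simp
  | add s t hs ht => simp only [map_add, hs, ht]
  | tmul a b =>
    rw [comulRight_tmul, theta_tmul, mulAntipode_comul]
    simp [Algebra.algebraMap_eq_smul_one]

lemma theta_incl (s t : H ⊗[k] H) :
    theta k H (inclLeft k H s * inclRight k H t) = antipodeMul k H s * mulAntipode k H t := by
  induction s with
  | zero => simp
  | add s t hs ht => simp only [map_add, add_mul, hs, ht]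
  | tmul a b =>
    induction t with
    | zero => simp
    | add s t hs ht => simp only [map_add, mul_add, hs, ht]
    | tmul c d => simp [inclLeft_tmul, inclRight_apply, mul_assoc]

lemma omega_comulRight_mul (t : H ⊗[k] H) (w : H ⊗[k] (H ⊗[k] H)) :
    omega k H (comulRight k H t * w) = counitRight k H t * omega k H w := by
  have key : ∀ (X : H ⊗[k] H) (a u v z : H),
      omega k H (a ⊗ₜ X * (u ⊗ₜ (v ⊗ₜ z))) =
      a * u * (HopfAlgebra.antipode k v * (antipodeMul k H X * z)) := by
    intro X b u v z
    induction X with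
    | zero => simp
    | add X Y hX hY => simp only [TensorProduct.tmul_add, map_add, add_mul, mul_add, hX, hY]
    | tmul x y => simp [HopfAlgebra.antipode_mul_antidistrib, mul_assoc]
  induction t with
  | zero => simp
  | add s t hs ht => simp only [map_add, add_mul, hs, ht]
  | tmul a b =>
    induction w with
    | zero => simp
    | add s t hs ht => simp only [map_add, mul_add, hs, ht]
    | tmul u w =>
      induction w with
      | zero => simp
      | add s t hs ht => simp only [TensorProduct.tmul_add, map_add, mul_add, hs, ht]
      | tmul v z =>
        rw [comulRight_tmul, key, antipodeMul_comul]
        simp [Algebra.algebraMap_eq_smul_one, mul_assoc]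

lemma omega_comulLeft (t : H ⊗[k] H) :
    omega k H (comulLeft k H t) = counitLeft k H t := by
  have key : ∀ (X : H ⊗[k] H) (b : H),
      omega k H (Algebra.TensorProduct.assoc k k k H H H (X ⊗ₜ b)) = mulAntipode k H X * b := by
    intro X b
    induction X with
    | zero => simp
    | add X Y hX hY => simp only [TensorProduct.add_tmul, map_add, add_mul, hX, hY]
    | tmul x y => simp [mul_assoc]
  induction t with
  | zero => simp
  | add s t hs ht => simp only [map_add, hs, ht]
  | tmul a b =>
    rw [comulLeft_tmul, key, mulAntipode_comul]
    simp [Algebra.algebraMap_eq_smul_one]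

lemma omega_incl (s t : H ⊗[k] H) :
    omega k H (inclRight k H t * inclLeft k H s) = mulAntipode k H s * antipodeMul k H t := by
  induction s with
  | zero => simp
  | add s t hs ht => simp only [map_add, add_mul, mul_add, hs, ht]
  | tmul a b =>
    induction t with
    | zero => simp
    | add s t hs ht => simp only [map_add, add_mul, mul_add, hs, ht]
    | tmul c d =>
      simp [inclLeft_tmul, inclRight_apply, mul_assoc, HopfAlgebra.antipode_mul_antidistrib]

variable (J : HopfTwist k H)

lemma counitLeft_inv : counitLeft k H ↑J.unit⁻¹ = 1 := by
  have h := congrArg (counitLeft k H) J.unit.mul_inv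
  rwa [map_mul, map_one, J.counitLeft_eq, one_mul] at h

lemma counitRight_inv : counitRight k H ↑J.unit⁻¹ = 1 := by
  have h := congrArg (counitRight k H) J.unit.mul_inv
  rwa [map_mul, map_one, J.counitRight_eq, one_mul] at h

lemma map_inv_mul {A B : Type*} [Ring A] [Ring B] [Algebra k A] [Algebra k B] (f : A →ₐ[k] B)
    (u : Aˣ) : f ↑u⁻¹ * f u = 1 := by
  rw [← map_mul, Units.inv_mul, map_one]

lemma map_mul_inv {A B : Type*} [Ring A] [Ring B] [Algebra k A] [Algebra k B] (f : A →ₐ[k] B)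
    (u : Aˣ) : f u * f ↑u⁻¹ = 1 := by
  rw [← map_mul, Units.mul_inv, map_one]

lemma incl_mul_incl_inv : inclLeft k H J.unit * inclRight k H ↑J.unit⁻¹ =
    comulLeft k H ↑J.unit⁻¹ * comulRight k H J.unit := by
  have h := congrArg (fun x => comulLeft k H ↑J.unit⁻¹ * x * inclRight k H ↑J.unit⁻¹) J.twist_eq
  rwa [← mul_assoc, map_inv_mul, one_mul, ← mul_assoc, mul_assoc _ _ (inclRight k H ↑J.unit⁻¹),
    map_mul_inv, mul_one] at h

lemma incl_mul_incl_inv' : inclRight k H J.unit * inclLeft k H ↑J.unit⁻¹ =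
    comulRight k H ↑J.unit⁻¹ * comulLeft k H J.unit := by
  have h := congrArg (fun x => comulRight k H ↑J.unit⁻¹ * x * inclLeft k H ↑J.unit⁻¹) J.twist_eq
  rw [← mul_assoc, mul_assoc _ _ (inclLeft k H ↑J.unit⁻¹), map_mul_inv, mul_one, ← mul_assoc,
    map_inv_mul, one_mul] at h
  exact h.symm

/-- The invertible element `Q_J = S(J⁽¹⁾) J⁽²⁾`, with inverse `J⁻⁽¹⁾ S(J⁻⁽²⁾)`. -/
noncomputable def Q : Hˣ where
  val := antipodeMul k H J.unit
  inv := mulAntipode k H ↑J.unit⁻¹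
  val_inv := by
    rw [← theta_incl, incl_mul_incl_inv, theta_comulLeft_mul, theta_comulRight, J.counitRight_eq,
      counitLeft_inv, HopfAlgebra.antipode_one, one_mul]
  inv_val := by
    rw [← omega_incl, incl_mul_incl_inv', omega_comulRight_mul, omega_comulLeft,
      J.counitLeft_eq, counitRight_inv, one_mul]

/-- The element `u_J = Q_J⁻¹ S(Q_J)`. -/
noncomputable def u : H := ↑J.Q⁻¹ * HopfAlgebra.antipode k (J.Q : H)

/-! ### The twisted Hopf algebra -/

/-- The twisted comultiplication `Δ^J(h) = J⁻¹ Δ(h) J`. -/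
noncomputable def twistedComul : H →ₐ[k] H ⊗[k] H :=
  AlgHom.ofLinearMap
    (LinearMap.mulLeft k (↑J.unit⁻¹ : H ⊗[k] H) ∘ₗ LinearMap.mulRight k (J.unit : H ⊗[k] H) ∘ₗ
      Coalgebra.comul)
    (by simp)
    (fun x y => by simp [mul_assoc])

lemma twistedComul_apply (h : H) :
    J.twistedComul h = ↑J.unit⁻¹ * (Coalgebra.comul (R := k) h * J.unit) := rfl

/-- The twisted antipode `S^J(h) = Q_J⁻¹ S(h) Q_J`. -/
noncomputable def twistedAntipode : H →ₗ[k] H :=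
  LinearMap.mulLeft k (↑J.Q⁻¹ : H) ∘ₗ LinearMap.mulRight k (J.Q : H) ∘ₗ HopfAlgebra.antipode k

lemma twistedAntipode_apply (h : H) :
    J.twistedAntipode h = ↑J.Q⁻¹ * (HopfAlgebra.antipode k h * J.Q) := rfl

lemma twistedComul_left (x : H ⊗[k] H) :
    Algebra.TensorProduct.assoc k k k H H H
      (Algebra.TensorProduct.map J.twistedComul (AlgHom.id k H) x) =
    inclLeft k H ↑J.unit⁻¹ * (comulLeft k H x * inclLeft k H J.unit) := by
  induction x with
  | zero => simp
  | add s t hs ht => simp only [map_add, add_mul, mul_add, hs, ht]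
  | tmul a b =>
    have : inclLeft k H ↑J.unit⁻¹ * (comulLeft k H (a ⊗ₜ b) * inclLeft k H J.unit) =
      Algebra.TensorProduct.assoc k k k H H H (((↑J.unit⁻¹ : H ⊗[k] H) ⊗ₜ[k] (1 : H)) *
        ((Coalgebra.comul (R := k) a ⊗ₜ[k] b) * ((J.unit : H ⊗[k] H) ⊗ₜ[k] (1 : H)))) := by
      rw [map_mul, map_mul]; rfl
    rw [this, Algebra.TensorProduct.tmul_mul_tmul, Algebra.TensorProduct.tmul_mul_tmul, one_mul,
      mul_one]
    rfl

lemma twistedComul_right (x : H ⊗[k] H) :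
    Algebra.TensorProduct.map (AlgHom.id k H) J.twistedComul x =
    inclRight k H ↑J.unit⁻¹ * (comulRight k H x * inclRight k H J.unit) := by
  induction x with
  | zero => simp
  | add s t hs ht => simp only [map_add, add_mul, mul_add, hs, ht]
  | tmul a b =>
    rw [inclRight_apply, inclRight_apply, comulRight_tmul, Algebra.TensorProduct.tmul_mul_tmul,
      Algebra.TensorProduct.tmul_mul_tmul, one_mul, mul_one]
    rfl

/-- The bialgebra structure of `H^J`, on the algebra `H`. -/
@[reducible] noncomputable def twistedBialgebra : Bialgebra k H :=
  Bialgebra.ofAlgHom J.twistedComul (Bialgebra.counitAlgHom k H)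
    (by
      ext h
      have e : inclLeft k H ↑J.unit⁻¹ * comulLeft k H ↑J.unit⁻¹ =
          inclRight k H ↑J.unit⁻¹ * comulRight k H ↑J.unit⁻¹ := by
        have h1 := map_inv_mul (inclLeft k H) J.unit
        have h2 := map_inv_mul (comulLeft k H) J.unit
        have h3 := map_mul_inv (inclRight k H) J.unit
        have h4 := map_mul_inv (comulRight k H) J.unit
        have h5 := J.twist_eq
        refine left_inv_eq_right_inv (a := comulLeft k H J.unit * inclLeft k H J.unit) ?_ ?_
        · rw [mul_assoc, ← mul_assoc (comulLeft k H ↑J.unit⁻¹), h2, one_mul, h1]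
        · rw [h5, mul_assoc, ← mul_assoc (inclRight k H J.unit), h3, one_mul, h4]
      have c : comulLeft k H (Coalgebra.comul (R := k) h) =
          comulRight k H (Coalgebra.comul (R := k) h) := Coalgebra.coassoc_apply h
      refine (J.twistedComul_left (J.twistedComul h)).trans
        (Eq.trans ?_ (J.twistedComul_right (J.twistedComul h)).symm)
      rw [twistedComul_apply]
      simp only [map_mul]
      rw [mul_assoc, mul_assoc, J.twist_eq, ← mul_assoc, e, c]
      simp only [mul_assoc])
    (by
      ext h
      apply (Algebra.TensorProduct.lid k H).injective
      change counitLeft k H (J.twistedComul h) = (1 : k) • h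
      rw [twistedComul_apply, map_mul, map_mul, counitLeft_inv, J.counitLeft_eq, one_mul, mul_one]
      exact congrArg (TensorProduct.lid k H) (Coalgebra.rTensor_counit_comul h))
    (by
      ext h
      apply (Algebra.TensorProduct.rid k k H).injective
      change counitRight k H (J.twistedComul h) = (1 : k) • h
      rw [twistedComul_apply, map_mul, map_mul, counitRight_inv, J.counitRight_eq, one_mul,
        mul_one]
      exact congrArg (TensorProduct.rid k H) (Coalgebra.lTensor_counit_comul h))

lemma antipodeMul_twisted (x : H ⊗[k] H) :
    LinearMap.mul' k H (J.twistedAntipode.rTensor H (↑J.unit⁻¹ * (x * J.unit))) =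
      ↑J.Q⁻¹ * antipodeMul k H (x * J.unit) := by
  have key : ∀ (s t : H ⊗[k] H),
      LinearMap.mul' k H (J.twistedAntipode.rTensor H (s * t)) =
      ↑J.Q⁻¹ * LinearMap.mul' k H (TensorProduct.map (HopfAlgebra.antipode k (A := H))
        (LinearMap.mulLeft k (LinearMap.mul' k H (TensorProduct.map
          (LinearMap.mulRight k (J.Q : H) ∘ₗ HopfAlgebra.antipode k) LinearMap.id s))) t) := by
    intro s t
    induction t with
    | zero => simp
    | add x y hx hy => simp only [map_add, mul_add, hx, hy]
    | tmul c d =>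
      induction s with
      | zero => simp
      | add x y hx hy =>
        simp only [map_add, mul_add, add_mul, hx, hy, TensorProduct.map_tmul,
          LinearMap.mul'_apply, LinearMap.mulLeft_apply]
      | tmul a b =>
        simp [twistedAntipode_apply, HopfAlgebra.antipode_mul_antidistrib, mul_assoc]
  have one : ∀ s t : H ⊗[k] H, LinearMap.mul' k H (TensorProduct.map
      (LinearMap.mulRight k (antipodeMul k H t) ∘ₗ HopfAlgebra.antipode k) LinearMap.id s) =
      antipodeMul k H (t * s) := by
    intro s t
    induction s with
    | zero => simp
    | add x y hx hy => simp only [map_add, mul_add, hx, hy]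
    | tmul c d =>
      induction t with
      | zero => simp
      | add x y hx hy =>
        simp only [TensorProduct.map_tmul, LinearMap.mul'_apply, LinearMap.comp_apply,
          LinearMap.mulRight_apply, LinearMap.id_apply] at hx hy
        simp only [map_add, mul_add, add_mul, TensorProduct.map_tmul, LinearMap.mul'_apply,
          LinearMap.comp_apply, LinearMap.mulRight_apply, LinearMap.id_apply, hx, hy]
      | tmul a b => simp [HopfAlgebra.antipode_mul_antidistrib, mul_assoc]
  rw [key]
  have hQ : (J.Q : H) = antipodeMul k H J.unit := rfl
  rw [hQ, one, Units.mul_inv]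
  simp [antipodeMul, LinearMap.rTensor, Algebra.TensorProduct.one_def]

lemma mulAntipode_twisted (x : H ⊗[k] H) :
    LinearMap.mul' k H (J.twistedAntipode.lTensor H (↑J.unit⁻¹ * x * J.unit)) =
      mulAntipode k H (↑J.unit⁻¹ * x) * J.Q := by
  have key : ∀ (s t : H ⊗[k] H),
      LinearMap.mul' k H (J.twistedAntipode.lTensor H (s * t)) =
      LinearMap.mul' k H (TensorProduct.map (LinearMap.mulRight k (LinearMap.mul' k H
        (TensorProduct.map LinearMap.id (LinearMap.mulLeft k (↑J.Q⁻¹ : H) ∘ₗ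
          HopfAlgebra.antipode k) t))) (HopfAlgebra.antipode k (A := H)) s) * J.Q := by
    intro s t
    induction s with
    | zero => simp
    | add x y hx hy => simp only [map_add, add_mul, hx, hy]
    | tmul a b =>
      induction t with
      | zero => simp
      | add x y hx hy =>
        simp only [map_add, mul_add, add_mul, hx, hy, TensorProduct.map_tmul,
          LinearMap.mul'_apply, LinearMap.mulRight_apply]
      | tmul c d =>
        simp [twistedAntipode_apply, HopfAlgebra.antipode_mul_antidistrib, mul_assoc]
  have one : ∀ s t : H ⊗[k] H, LinearMap.mul' k H (TensorProduct.map LinearMap.id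
      (LinearMap.mulLeft k (mulAntipode k H t) ∘ₗ HopfAlgebra.antipode k) s) =
      mulAntipode k H (s * t) := by
    intro s t
    induction s with
    | zero => simp
    | add x y hx hy => simp only [map_add, add_mul, hx, hy]
    | tmul c d =>
      induction t with
      | zero => simp
      | add x y hx hy =>
        simp only [TensorProduct.map_tmul, LinearMap.mul'_apply, LinearMap.comp_apply,
          LinearMap.mulLeft_apply, LinearMap.id_apply] at hx hy
        simp only [map_add, mul_add, add_mul, TensorProduct.map_tmul, LinearMap.mul'_apply,
          LinearMap.comp_apply, LinearMap.mulLeft_apply, LinearMap.id_apply, hx, hy]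
      | tmul a b => simp [HopfAlgebra.antipode_mul_antidistrib, mul_assoc]
  rw [key]
  have hQ : (↑J.Q⁻¹ : H) = mulAntipode k H ↑J.unit⁻¹ := rfl
  rw [hQ, one, Units.mul_inv]
  simp [mulAntipode, LinearMap.lTensor, Algebra.TensorProduct.one_def]

lemma antipodeMul_twisted_comul (h : H) :
    LinearMap.mul' k H (J.twistedAntipode.rTensor H (J.twistedComul h)) =
      algebraMap k H (Coalgebra.counit h) := by
  have key : ∀ s t : H ⊗[k] H, antipodeMul k H (s * t) = LinearMap.mul' k H (TensorProduct.map
      (HopfAlgebra.antipode k (A := H)) (LinearMap.mulLeft k (antipodeMul k H s)) t) := by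
    intro s t
    induction t with
    | zero => simp
    | add x y hx hy => simp only [map_add, mul_add, hx, hy]
    | tmul c d =>
      induction s with
      | zero => simp
      | add x y hx hy =>
        simp only [map_add, mul_add, add_mul, hx, hy, TensorProduct.map_tmul,
          LinearMap.mul'_apply, LinearMap.mulLeft_apply]
      | tmul a b => simp [HopfAlgebra.antipode_mul_antidistrib, mul_assoc]
  have sc : ∀ (c : k) (t : H ⊗[k] H), LinearMap.mul' k H (TensorProduct.map
      (HopfAlgebra.antipode k (A := H)) (LinearMap.mulLeft k (algebraMap k H c)) t) =
      c • antipodeMul k H t := by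
    intro c t
    induction t with
    | zero => simp
    | add x y hx hy => simp only [map_add, smul_add, hx, hy]
    | tmul a b => simp [Algebra.algebraMap_eq_smul_one]
  rw [twistedComul_apply, antipodeMul_twisted, key, antipodeMul_comul, sc, mul_smul_comm]
  have hQ : antipodeMul k H J.unit = (J.Q : H) := rfl
  rw [hQ, Units.inv_mul, Algebra.algebraMap_eq_smul_one]

lemma mulAntipode_twisted_comul (h : H) :
    LinearMap.mul' k H (J.twistedAntipode.lTensor H (J.twistedComul h)) =
      algebraMap k H (Coalgebra.counit h) := by
  have key : ∀ s t : H ⊗[k] H, mulAntipode k H (s * t) = LinearMap.mul' k H (TensorProduct.map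
      (LinearMap.mulRight k (mulAntipode k H t)) (HopfAlgebra.antipode k (A := H)) s) := by
    intro s t
    induction s with
    | zero => simp
    | add x y hx hy => simp only [map_add, add_mul, hx, hy]
    | tmul c d =>
      induction t with
      | zero => simp
      | add x y hx hy =>
        simp only [map_add, mul_add, add_mul, hx, hy, TensorProduct.map_tmul,
          LinearMap.mul'_apply, LinearMap.mulRight_apply]
      | tmul a b => simp [HopfAlgebra.antipode_mul_antidistrib, mul_assoc]
  have sc : ∀ (c : k) (t : H ⊗[k] H), LinearMap.mul' k H (TensorProduct.map
      (LinearMap.mulRight k (algebraMap k H c)) (HopfAlgebra.antipode k (A := H)) t) =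
      c • mulAntipode k H t := by
    intro c t
    induction t with
    | zero => simp
    | add x y hx hy => simp only [map_add, smul_add, hx, hy]
    | tmul a b => simp [Algebra.algebraMap_eq_smul_one]
  rw [twistedComul_apply, ← mul_assoc, mulAntipode_twisted, key, mulAntipode_comul, sc,
    smul_mul_assoc]
  have hQ : mulAntipode k H ↑J.unit⁻¹ = (↑J.Q⁻¹ : H) := rfl
  rw [hQ, Units.inv_mul, Algebra.algebraMap_eq_smul_one]

/-- The Hopf algebra structure of `H^J`, on the algebra `H`. -/
@[reducible] noncomputable def twistedHopfAlgebra : HopfAlgebra k H where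
  toBialgebra := J.twistedBialgebra
  antipode := J.twistedAntipode
  mul_antipode_rTensor_comul := LinearMap.ext J.antipodeMul_twisted_comul
  mul_antipode_lTensor_comul := LinearMap.ext J.mulAntipode_twisted_comul

/-- The underlying type of the twisted Hopf algebra `H^J`, a copy of `H`. -/
def Twisted (_J : HopfTwist k H) : Type _ := H

/-- `H^J` is `H` as a ring. -/
noncomputable instance : Ring J.Twisted := inferInstanceAs (Ring H)

/-- `H^J` has the algebra structure and counit of `H`, the comultiplication
`Δ^J(h) = J⁻¹ Δ(h) J` and the antipode `S^J(h) = Q_J⁻¹ S(h) Q_J`. -/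
noncomputable instance : HopfAlgebra k J.Twisted := J.twistedHopfAlgebra

/-- The identity map `H → H^J`, an isomorphism of algebras. -/
noncomputable def toTwisted : H ≃ₐ[k] J.Twisted := AlgEquiv.refl (R := k) (A₁ := H)

lemma counit_toTwisted (h : H) :
    Coalgebra.counit (R := k) (J.toTwisted h) = Coalgebra.counit (R := k) h := rfl

lemma comul_toTwisted (h : H) :
    Coalgebra.comul (R := k) (J.toTwisted h) =
      TensorProduct.map J.toTwisted.toLinearMap J.toTwisted.toLinearMap
        (↑J.unit⁻¹ * Coalgebra.comul (R := k) h * ↑J.unit) := by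
  have : ∀ x : H ⊗[k] H,
      TensorProduct.map J.toTwisted.toLinearMap J.toTwisted.toLinearMap x = x := fun x =>
    LinearMap.congr_fun (TensorProduct.map_id (R := k) (M := H) (N := H)) x
  rw [mul_assoc]
  exact (this _).symm

lemma antipode_toTwisted (h : H) :
    HopfAlgebra.antipode k (J.toTwisted h) =
      J.toTwisted (↑J.Q⁻¹ * HopfAlgebra.antipode k h * ↑J.Q) := by
  rw [mul_assoc]
  rfl

end Elements

end HopfTwist

/-! The dual algebra acts on a coalgebra by `hitL p : x ↦ p(x₁)x₂` and `hitR p : x ↦ x₁p(x₂)`. The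
proof rests on one element Λ, the character of a regular representation of the dual: p(Λ) = tr(`hitR
p`). Cosemisimplicity gives an integral l on H with l(1) = 1. Since S² = id, Λ is a two-sided
integral; it is cocommutative because traces are cyclic, and l(Λ) = 1 because `hitR l` has rank one
(`exists_integral`). The normalization is l(Λ) = 1 rather than a condition on ε(Λ) = dim H, which
may vanish in k; hence the characteristic plays no role.

The integral property lets a tensor leg slide past Δ(Λ), so Δ(Λ)J = Δ(Λ)(1 ⊗ Q), and flipping the
legs multiplies this element by 1 ⊗ u. Iterating to three legs and rotating cyclically yields Δ(u)J
= J(u ⊗ u) (`comul_u_mul`): u is grouplike in H^J. A translate l' of l is an integral on H^J with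
l'(u) = l(1) = 1. Evaluating the integral identity at a grouplike element gives l'(u)u = l'(u)1,
hence u = 1 (`u_eq_one`).

Now S(Q) = Q, so H^J is involutive, and Λ and l still satisfy the relations needed there. These make
l(S(x)y) a separability form, and a Maschke averaging argument (`isCosemisimple_of_integral`) gives
cosemisimplicity. -/

namespace HopfTwist

/-! ### Actions of the dual on a coalgebra, and cosemisimplicity as module semisimplicity. -/

section Contractions

variable {k C : Type*} [Field k] [AddCommGroup C] [Module k C]

/-- `x ⊗ y ↦ p(x) y`. -/
noncomputable def contrL (p : C →ₗ[k] k) : C ⊗[k] C →ₗ[k] C :=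
  (TensorProduct.lid k C).toLinearMap ∘ₗ p.rTensor C

/-- `x ⊗ y ↦ p(y) x`. -/
noncomputable def contrR (p : C →ₗ[k] k) : C ⊗[k] C →ₗ[k] C :=
  (TensorProduct.rid k C).toLinearMap ∘ₗ p.lTensor C

@[simp] lemma contrL_tmul (p : C →ₗ[k] k) (x y : C) : contrL p (x ⊗ₜ y) = p x • y := rfl

@[simp] lemma contrR_tmul (p : C →ₗ[k] k) (x y : C) : contrR p (x ⊗ₜ y) = p y • x := rfl

lemma contrL_comm (p : C →ₗ[k] k) (t : C ⊗[k] C) :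
    contrL p (TensorProduct.comm k C C t) = contrR p t := by
  induction t with
  | zero => simp
  | add s t hs ht => simp only [map_add, hs, ht]
  | tmul a b => simp

lemma apply_contrL (p q : C →ₗ[k] k) (t : C ⊗[k] C) : q (contrL p t) = p (contrR q t) := by
  induction t with
  | zero => simp
  | add s t hs ht => simp only [map_add, hs, ht]
  | tmul a b => simp [mul_comm]

lemma contrL_add (p q : C →ₗ[k] k) : contrL (p + q) = contrL p + contrL q := by
  ext; simp [add_smul]

lemma contrR_add (p q : C →ₗ[k] k) : contrR (p + q) = contrR p + contrR q := by
  ext; simp [add_smul]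

lemma contrL_smul (c : k) (p : C →ₗ[k] k) : contrL (c • p) = c • contrL p := by
  ext; simp [mul_smul]

lemma contrR_smul (c : k) (p : C →ₗ[k] k) : contrR (c • p) = c • contrR p := by
  ext; simp [mul_smul]

/-- Contractions against all functionals separate the points of `C ⊗ C`. -/
lemma eq_of_contrR_eq {s t : C ⊗[k] C} (h : ∀ p : C →ₗ[k] k, contrR p s = contrR p t) :
    s = t := by
  classical
  let b := Module.Basis.ofVectorSpace k C
  have key : ∀ t : C ⊗[k] C, ∀ i, contrR (b.coord i) t =
      (TensorProduct.equivFinsuppOfBasisRight b t) i := by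
    intro t i
    induction t with
    | zero => simp
    | add s t hs ht => simp only [map_add, hs, ht, Finsupp.add_apply]
    | tmul x y => simp [TensorProduct.equivFinsuppOfBasisRight_apply_tmul]
  apply (TensorProduct.equivFinsuppOfBasisRight (M := C) b).injective
  ext i
  rw [← key, ← key, h]

lemma eq_of_contrL_eq {s t : C ⊗[k] C} (h : ∀ p : C →ₗ[k] k, contrL p s = contrL p t) :
    s = t := by
  apply (TensorProduct.comm k C C).injective
  apply eq_of_contrR_eq
  intro p
  rw [← contrL_comm, ← contrL_comm]
  simpa using h p

/-- A linear projection onto D, applied in either leg, fixes t, because this can be tested on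
contractions of the other leg. Applying it in both legs exhibits t as a tensor over D. -/
lemma mem_range_map_subtype {D : Submodule k C} {t : C ⊗[k] C}
    (hR : ∀ p : C →ₗ[k] k, contrR p t ∈ D) (hL : ∀ p : C →ₗ[k] k, contrL p t ∈ D) :
    t ∈ LinearMap.range (TensorProduct.map D.subtype D.subtype) := by
  obtain ⟨π, hπ⟩ := D.subtype.exists_leftInverse_of_injective D.ker_subtype
  have hfix : ∀ x ∈ D, D.subtype (π x) = x := fun x hx =>
    congrArg D.subtype (LinearMap.congr_fun hπ ⟨x, hx⟩)
  have h1 : (D.subtype ∘ₗ π).rTensor C t = t := by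
    apply eq_of_contrR_eq
    intro p
    have : ∀ s : C ⊗[k] C, contrR p ((D.subtype ∘ₗ π).rTensor C s) =
        D.subtype (π (contrR p s)) := by
      intro s
      induction s with
      | zero => simp
      | add s t hs ht => simp only [map_add, hs, ht]
      | tmul x y => simp
    rw [this, hfix _ (hR p)]
  have h2 : (D.subtype ∘ₗ π).lTensor C t = t := by
    apply eq_of_contrL_eq
    intro p
    have : ∀ s : C ⊗[k] C, contrL p ((D.subtype ∘ₗ π).lTensor C s) =
        D.subtype (π (contrL p s)) := by
      intro s
      induction s with
      | zero => simp
      | add s t hs ht => simp only [map_add, hs, ht]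
      | tmul x y => simp
    rw [this, hfix _ (hL p)]
  refine ⟨TensorProduct.map π π t, ?_⟩
  rw [← LinearMap.comp_apply, ← TensorProduct.map_comp]
  conv_rhs => rw [← h1]
  conv_rhs => rw [← h2]
  rw [← LinearMap.comp_apply, LinearMap.rTensor_comp_lTensor]

lemma contrR_lTensor (p : C →ₗ[k] k) (f : C →ₗ[k] C) (t : C ⊗[k] C) :
    contrR p (f.lTensor C t) = contrR (p ∘ₗ f) t := by
  induction t with
  | zero => simp
  | add s t hs ht => simp only [map_add, hs, ht]
  | tmul a b => simp

lemma contrL_lTensor (p : C →ₗ[k] k) (f : C →ₗ[k] C) (t : C ⊗[k] C) :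
    contrL p (f.lTensor C t) = f (contrL p t) := by
  induction t with
  | zero => simp
  | add s t hs ht => simp only [map_add, hs, ht]
  | tmul a b => simp

lemma contrL_rTensor (p : C →ₗ[k] k) (f : C →ₗ[k] C) (t : C ⊗[k] C) :
    contrL p (f.rTensor C t) = contrL (p ∘ₗ f) t := by
  induction t with
  | zero => simp
  | add s t hs ht => simp only [map_add, hs, ht]
  | tmul a b => simp

variable [Coalgebra k C]

/-- `x ↦ p(x₁) x₂`. -/
noncomputable def hitL (p : C →ₗ[k] k) : C →ₗ[k] C := contrL p ∘ₗ Coalgebra.comul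

/-- `x ↦ x₁ p(x₂)`. -/
noncomputable def hitR (p : C →ₗ[k] k) : C →ₗ[k] C := contrR p ∘ₗ Coalgebra.comul

lemma hitL_apply (p : C →ₗ[k] k) (x : C) : hitL p x = contrL p (Coalgebra.comul x) := rfl

lemma hitR_apply (p : C →ₗ[k] k) (x : C) : hitR p x = contrR p (Coalgebra.comul x) := rfl

lemma apply_hitL (p q : C →ₗ[k] k) (x : C) : q (hitL p x) = p (hitR q x) := apply_contrL p q _

lemma hitL_counit : hitL (Coalgebra.counit : C →ₗ[k] k) = LinearMap.id := by
  ext x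
  simp [hitL, contrL]

lemma hitR_counit : hitR (Coalgebra.counit : C →ₗ[k] k) = LinearMap.id := by
  ext x
  simp [hitR, contrR]

lemma comul_hitR (p : C →ₗ[k] k) (x : C) :
    Coalgebra.comul (R := k) (hitR p x) = (hitR p).lTensor C (Coalgebra.comul x) := by
  have key : ∀ t : C ⊗[k] C, Coalgebra.comul (R := k) (contrR p t) =
      (contrR p).lTensor C (TensorProduct.assoc k C C C (Coalgebra.comul.rTensor C t)) := by
    intro t
    induction t with
    | zero => simp
    | add s t hs ht => simp only [map_add, hs, ht]
    | tmul a b =>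
      have : ∀ s : C ⊗[k] C, p b • s =
          (contrR p).lTensor C (TensorProduct.assoc k C C C (s ⊗ₜ b)) := by
        intro s
        induction s with
        | zero => simp
        | add s t hs ht => simp only [smul_add, map_add, TensorProduct.add_tmul, hs, ht]
        | tmul x y => simp
      simp only [contrR_tmul, map_smul, LinearMap.rTensor_tmul, this]
  rw [hitR_apply, key, Coalgebra.coassoc_apply, hitR, LinearMap.lTensor_comp_apply]

lemma comul_hitL (p : C →ₗ[k] k) (x : C) :
    Coalgebra.comul (R := k) (hitL p x) = (hitL p).rTensor C (Coalgebra.comul x) := by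
  have key : ∀ t : C ⊗[k] C, Coalgebra.comul (R := k) (contrL p t) =
      (contrL p).rTensor C ((TensorProduct.assoc k C C C).symm (Coalgebra.comul.lTensor C t)) := by
    intro t
    induction t with
    | zero => simp
    | add s t hs ht => simp only [map_add, hs, ht]
    | tmul a b =>
      have : ∀ s : C ⊗[k] C, p a • s =
          (contrL p).rTensor C ((TensorProduct.assoc k C C C).symm (a ⊗ₜ s)) := by
        intro s
        induction s with
        | zero => simp
        | add s t hs ht => simp only [smul_add, map_add, TensorProduct.tmul_add, hs, ht]
        | tmul x y => simp [TensorProduct.smul_tmul']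
      simp only [contrL_tmul, map_smul, LinearMap.lTensor_tmul, this]
  rw [hitL_apply, key, Coalgebra.coassoc_symm_apply, hitL, LinearMap.rTensor_comp_apply]

/-- Here `p ∘ₗ hitR q` is the convolution product p * q, so `hitR` represents the dual algebra. In
the same way `hitL` represents its opposite, and coassociativity makes the two actions commute. -/
lemma hitR_hitR (p q : C →ₗ[k] k) (x : C) : hitR p (hitR q x) = hitR (p ∘ₗ hitR q) x := by
  rw [hitR_apply p, comul_hitR, contrR_lTensor, hitR_apply]

lemma hitL_hitR (p q : C →ₗ[k] k) (x : C) : hitL p (hitR q x) = hitR q (hitL p x) := by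
  rw [hitL_apply p, comul_hitR, contrL_lTensor, hitL_apply]

lemma hitL_hitL (p q : C →ₗ[k] k) (x : C) : hitL p (hitL q x) = hitL (p ∘ₗ hitL q) x := by
  rw [hitL_apply p, comul_hitL, contrL_rTensor, hitL_apply]

lemma comp_hitL (p q : C →ₗ[k] k) : q ∘ₗ hitL p = p ∘ₗ hitR q :=
  LinearMap.ext fun x => apply_hitL p q x

/-- Subcoalgebras are the subspaces stable under all `hitL p` and `hitR p`. -/
lemma isSubcoalgebra_iff {D : Submodule k C} : IsSubcoalgebra k D ↔
    ∀ p : C →ₗ[k] k, ∀ x ∈ D, hitL p x ∈ D ∧ hitR p x ∈ D := by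
  constructor
  · intro h p x hx
    obtain ⟨t, ht⟩ := h x hx
    rw [hitL_apply, hitR_apply, ← ht]
    clear ht
    induction t with
    | zero => simp
    | add s t hs ht =>
      simp only [map_add]
      exact ⟨add_mem hs.1 ht.1, add_mem hs.2 ht.2⟩
    | tmul a b =>
      simp only [TensorProduct.map_tmul, contrL_tmul, contrR_tmul]
      exact ⟨D.smul_mem _ b.2, D.smul_mem _ a.2⟩
  · intro h x hx
    exact mem_range_map_subtype (fun p => (h p x hx).2) (fun p => (h p x hx).1)

variable (k C) in
/-- The algebra of endomorphisms of a coalgebra generated by the two actions of its dual. -/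
noncomputable def hitAlgebra : Subalgebra k (Module.End k C) :=
  Algebra.adjoin k (Set.range hitL ∪ Set.range hitR)

/-- A subcoalgebra as a submodule for `hitAlgebra`. -/
noncomputable def hitSubmodule (D : Submodule k C) (hD : IsSubcoalgebra k D) :
    Submodule (hitAlgebra k C) C :=
  { D with
    smul_mem' := by
      rintro ⟨f, hf⟩ x hx
      suffices h : ∀ y ∈ D, f y ∈ D from h x hx
      clear hx x
      induction hf using Algebra.adjoin_induction with
      | mem f hf =>
        intro x hx
        rcases hf with ⟨p, rfl⟩ | ⟨p, rfl⟩
        · exact (isSubcoalgebra_iff.1 hD p x hx).1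
        · exact (isSubcoalgebra_iff.1 hD p x hx).2
      | algebraMap r => exact fun x hx => D.smul_mem r hx
      | add f g _ _ hf hg => exact fun x hx => D.add_mem (hf x hx) (hg x hx)
      | mul f g _ _ hf hg => exact fun x hx => hf _ (hg x hx) }

lemma isSubcoalgebra_restrictScalars (N : Submodule (hitAlgebra k C) C) :
    IsSubcoalgebra k (N.restrictScalars k) :=
  isSubcoalgebra_iff.2 fun p _ hx =>
    ⟨N.smul_mem ⟨hitL p, Algebra.subset_adjoin (Or.inl ⟨p, rfl⟩)⟩ hx,
      N.smul_mem ⟨hitR p, Algebra.subset_adjoin (Or.inr ⟨p, rfl⟩)⟩ hx⟩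

lemma isSimpleSubcoalgebra_restrictScalars_iff (N : Submodule (hitAlgebra k C) C) :
    IsSimpleSubcoalgebra k (N.restrictScalars k) ↔ IsSimpleModule (hitAlgebra k C) N := by
  rw [isSimpleModule_iff_isAtom]
  constructor
  · rintro ⟨-, h0, h⟩
    refine ⟨fun e => h0 (by rw [e]; rfl), fun M hM => ?_⟩
    rcases h (M.restrictScalars k) (isSubcoalgebra_restrictScalars M) hM.le with e | e
    · exact Submodule.restrictScalars_injective k _ _ e
    · exact absurd (Submodule.restrictScalars_injective k _ _ e) hM.ne
  · intro h
    refine ⟨isSubcoalgebra_restrictScalars N, fun e => h.1 ?_, fun E hE hle => ?_⟩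
    · exact Submodule.restrictScalars_injective k _ _ e
    · rcases h.le_iff.1 (show hitSubmodule E hE ≤ N from hle) with e | e
      · exact Or.inl (congrArg (Submodule.restrictScalars k) e)
      · exact Or.inr (congrArg (Submodule.restrictScalars k) e)

/-- Subcoalgebras are exactly the `hitAlgebra`-submodules, and simple ones correspond to simple
submodules. This makes the equivalence between sums of simples and existence of complements
available for coalgebras. -/
lemma isCosemisimple_iff : IsCosemisimple k C ↔ IsSemisimpleModule (hitAlgebra k C) C := by
  constructor
  · intro h
    apply IsSemisimpleModule.of_sSup_simples_eq_top
    apply Submodule.restrictScalars_injective k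
    apply top_unique (a := Submodule.restrictScalars k _)
    refine h.ge.trans (sSup_le fun D hD => ?_)
    exact le_sSup (a := hitSubmodule D hD.1)
      ((isSimpleSubcoalgebra_restrictScalars_iff (hitSubmodule D hD.1)).1 hD)
  · intro h
    have h' := IsSemisimpleModule.sSup_simples_eq_top (hitAlgebra k C) C
    let S := sSup {D : Submodule k C | IsSimpleSubcoalgebra k D}
    have hS : IsSubcoalgebra k S := by
      rw [isSubcoalgebra_iff]
      intro p x hx
      have : ∀ f : C →ₗ[k] C, (∀ D, IsSimpleSubcoalgebra k D → ∀ x ∈ D, f x ∈ D) → S ≤ S.comap f :=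
        fun f hf => sSup_le fun D hD x hx => le_sSup (a := D) hD (hf D hD x hx)
      exact ⟨this _ (fun D hD x hx => (isSubcoalgebra_iff.1 hD.1 p x hx).1) hx,
        this _ (fun D hD x hx => (isSubcoalgebra_iff.1 hD.1 p x hx).2) hx⟩
    have hle : (⊤ : Submodule (hitAlgebra k C) C) ≤ hitSubmodule S hS := by
      rw [← h']
      refine sSup_le fun N hN => ?_
      exact le_sSup (a := N.restrictScalars k)
        ((isSimpleSubcoalgebra_restrictScalars_iff N).2 hN)
    exact eq_top_iff.2 fun x _ => hle (Submodule.mem_top : x ∈ ⊤)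

end Contractions

end HopfTwist

/-! ### Integrals in H and in its dual. -/

namespace HopfTwist

lemma eq_of_forall_apply_eq {k V : Type*} [Field k] [AddCommGroup V] [Module k V] {x y : V}
    (h : ∀ p : V →ₗ[k] k, p x = p y) : x = y := by
  rw [← sub_eq_zero, ← Module.forall_dual_apply_eq_zero_iff k]
  intro p
  rw [map_sub, sub_eq_zero]
  exact h p

section Integrals

open Coalgebra HopfAlgebra

variable {k H : Type*} [Field k] [Ring H] [HopfAlgebra k H]

lemma antipode_antipode (hinv : IsInvolutiveHopf k H) (x : H) :
    antipode k (antipode k x) = x := LinearMap.congr_fun hinv x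

lemma antipode_antipodeMul (hinv : IsInvolutiveHopf k H) (t : H ⊗[k] H) :
    antipode k (antipodeMul k H t) = antipodeMul k H (TensorProduct.comm k H H t) := by
  induction t with
  | zero => simp
  | add s t hs ht => simp only [map_add, hs, ht]
  | tmul a b => simp [antipode_mul_antidistrib, antipode_antipode hinv]

lemma antipode_mulAntipode (hinv : IsInvolutiveHopf k H) (t : H ⊗[k] H) :
    antipode k (mulAntipode k H t) = mulAntipode k H (TensorProduct.comm k H H t) := by
  induction t with
  | zero => simp
  | add s t hs ht => simp only [map_add, hs, ht]
  | tmul a b => simp [antipode_mul_antidistrib, antipode_antipode hinv]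

lemma antipode_algebraMap (c : k) : antipode k (algebraMap k H c) = algebraMap k H c := by
  simp [Algebra.algebraMap_eq_smul_one]

/-- Applying S to S(x₁)x₂ = ε(x) and using S² = id gives S(x₂)x₁ = ε(x), the antipode axiom with its
legs in the wrong order. Involutivity enters the integral computations through this identity and its
mirror image. -/
lemma antipodeMul_comm_comul (hinv : IsInvolutiveHopf k H) (x : H) :
    antipodeMul k H (TensorProduct.comm k H H (comul (R := k) x)) = algebraMap k H (counit x) := by
  rw [← antipode_antipodeMul hinv, antipodeMul_comul, antipode_algebraMap]

lemma mulAntipode_comm_comul (hinv : IsInvolutiveHopf k H) (x : H) :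
    mulAntipode k H (TensorProduct.comm k H H (comul (R := k) x)) = algebraMap k H (counit x) := by
  rw [← antipode_mulAntipode hinv, mulAntipode_comul, antipode_algebraMap]

lemma sum_lTensor_comul_tmul (m : H ⊗[k] H →ₗ[k] H)
    (hm : ∀ y, m (comul y) = algebraMap k H (counit y)) {ι : Type*} {z : H} (r : Repr k z ι) :
    ∑ i ∈ r.index, m.lTensor H (TensorProduct.assoc k H H H (comul (r.left i) ⊗ₜ r.right i)) =
      z ⊗ₜ 1 := by
  have h1 : ∑ i ∈ r.index, (comul (R := k) (r.left i) ⊗ₜ[k] r.right i) =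
      comul.rTensor H (comul (R := k) z) := by
    rw [← r.eq, map_sum]; rfl
  have h2 : m ∘ₗ comul = Algebra.linearMap k H ∘ₗ counit := LinearMap.ext hm
  rw [← map_sum, ← map_sum, h1, coassoc_apply, ← LinearMap.lTensor_comp_apply, h2,
    LinearMap.lTensor_comp_apply, lTensor_counit_comul]
  simp

lemma sum_rTensor_tmul_comul (m : H ⊗[k] H →ₗ[k] H)
    (hm : ∀ y, m (comul y) = algebraMap k H (counit y)) {ι : Type*} {z : H} (r : Repr k z ι) :
    ∑ i ∈ r.index,
        m.rTensor H ((TensorProduct.assoc k H H H).symm (r.left i ⊗ₜ comul (r.right i))) =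
      1 ⊗ₜ z := by
  have h1 : ∑ i ∈ r.index, (r.left i ⊗ₜ[k] comul (R := k) (r.right i)) =
      comul.lTensor H (comul (R := k) z) := by
    rw [← r.eq, map_sum]; rfl
  have h2 : m ∘ₗ comul = Algebra.linearMap k H ∘ₗ counit := LinearMap.ext hm
  rw [← map_sum, ← map_sum, h1, coassoc_symm_apply, ← LinearMap.rTensor_comp_apply, h2,
    LinearMap.rTensor_comp_apply, rTensor_counit_comul]
  simp

lemma sum_antipode_tmul_mul_comul {ι : Type*} {z : H} (r : Repr k z ι) :
    ∑ i ∈ r.index, (antipode k (r.left i) ⊗ₜ[k] (1 : H)) * comul (r.right i) = 1 ⊗ₜ z := by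
  rw [← sum_rTensor_tmul_comul (antipodeMul k H) antipodeMul_comul r]
  refine Finset.sum_congr rfl fun i _ => ?_
  induction comul (R := k) (r.right i) with
  | zero => simp
  | add s t hs ht => simp only [map_add, TensorProduct.tmul_add, mul_add, hs, ht]
  | tmul a b => simp

lemma sum_comul_mul_antipode_tmul (hinv : IsInvolutiveHopf k H) {ι : Type*} {z : H}
    (r : Repr k z ι) :
    ∑ i ∈ r.index, comul (r.right i) * (antipode k (r.left i) ⊗ₜ[k] (1 : H)) = 1 ⊗ₜ z := by
  rw [← sum_rTensor_tmul_comul (mulAntipode k H ∘ₗ (TensorProduct.comm k H H).toLinearMap)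
    (mulAntipode_comm_comul hinv) r]
  refine Finset.sum_congr rfl fun i _ => ?_
  induction comul (R := k) (r.right i) with
  | zero => simp
  | add s t hs ht => simp only [map_add, TensorProduct.tmul_add, add_mul, hs, ht]
  | tmul a b => simp

lemma sum_comul_mul_tmul_antipode {ι : Type*} {z : H} (r : Repr k z ι) :
    ∑ i ∈ r.index, comul (r.left i) * ((1 : H) ⊗ₜ[k] antipode k (r.right i)) = z ⊗ₜ 1 := by
  rw [← sum_lTensor_comul_tmul (mulAntipode k H) mulAntipode_comul r]
  refine Finset.sum_congr rfl fun i _ => ?_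
  induction comul (R := k) (r.left i) with
  | zero => simp
  | add s t hs ht => simp only [map_add, TensorProduct.add_tmul, add_mul, hs, ht]
  | tmul a b => simp

lemma sum_tmul_antipode_mul_comul (hinv : IsInvolutiveHopf k H) {ι : Type*} {z : H}
    (r : Repr k z ι) :
    ∑ i ∈ r.index, ((1 : H) ⊗ₜ[k] antipode k (r.right i)) * comul (r.left i) = z ⊗ₜ 1 := by
  rw [← sum_lTensor_comul_tmul (antipodeMul k H ∘ₗ (TensorProduct.comm k H H).toLinearMap)
    (antipodeMul_comm_comul hinv) r]
  refine Finset.sum_congr rfl fun i _ => ?_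
  induction comul (R := k) (r.left i) with
  | zero => simp
  | add s t hs ht => simp only [map_add, TensorProduct.add_tmul, mul_add, hs, ht]
  | tmul a b => simp

/-- `Δ(Λ) (z ⊗ 1) = Δ(Λ) (1 ⊗ S(z))` for a right integral `Λ`. -/
lemma comul_mul_tmul_one {Λ : H} (hΛ : ∀ z, Λ * z = counit (R := k) z • Λ) (z : H) :
    comul (R := k) Λ * (z ⊗ₜ 1) = comul (R := k) Λ * (1 ⊗ₜ antipode k z) := by
  have h := sum_comul_mul_tmul_antipode (ℛ k z)
  have h2 : ∀ x y : H, comul (R := k) (Λ * x) * (1 ⊗ₜ antipode k y) =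
      comul Λ * (1 ⊗ₜ antipode k (counit (R := k) x • y)) := fun x y => by
    simp [hΛ]
  rw [← h, Finset.mul_sum]
  simp only [← mul_assoc, ← Bialgebra.comul_mul, h2]
  rw [← Finset.mul_sum, ← TensorProduct.tmul_sum, ← map_sum, sum_counit_smul]

/-- `(z ⊗ 1) Δ(Λ) = (1 ⊗ S(z)) Δ(Λ)` for a left integral `Λ` of an involutive Hopf algebra. -/
lemma tmul_one_mul_comul (hinv : IsInvolutiveHopf k H) {Λ : H}
    (hΛ : ∀ z, z * Λ = counit (R := k) z • Λ) (z : H) :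
    (z ⊗ₜ 1) * comul (R := k) Λ = (1 ⊗ₜ antipode k z) * comul (R := k) Λ := by
  have h := sum_tmul_antipode_mul_comul hinv (ℛ k z)
  have h2 : ∀ x y : H, (1 ⊗ₜ antipode k y) * comul (R := k) (x * Λ) =
      (1 ⊗ₜ antipode k (counit (R := k) x • y)) * comul Λ := fun x y => by
    simp [hΛ]
  rw [← h, Finset.sum_mul]
  simp only [mul_assoc, ← Bialgebra.comul_mul, h2]
  rw [← Finset.sum_mul, ← TensorProduct.tmul_sum, ← map_sum, sum_counit_smul]

lemma contrL_mul_tmul (p : H →ₗ[k] k) (t : H ⊗[k] H) (a b : H) :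
    contrL p (t * (a ⊗ₜ b)) = contrL (p ∘ₗ LinearMap.mulRight k a) t * b := by
  induction t with
  | zero => simp
  | add s t hs ht => simp only [map_add, add_mul, hs, ht]
  | tmul x y => simp

lemma contrL_tmul_mul (p : H →ₗ[k] k) (t : H ⊗[k] H) (a b : H) :
    contrL p ((a ⊗ₜ b) * t) = b * contrL (p ∘ₗ LinearMap.mulLeft k a) t := by
  induction t with
  | zero => simp
  | add s t hs ht => simp only [map_add, mul_add, hs, ht]
  | tmul x y => simp

lemma contrR_mul_tmul (p : H →ₗ[k] k) (t : H ⊗[k] H) (a b : H) :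
    contrR p (t * (a ⊗ₜ b)) = contrR (p ∘ₗ LinearMap.mulRight k b) t * a := by
  induction t with
  | zero => simp
  | add s t hs ht => simp only [map_add, add_mul, hs, ht]
  | tmul x y => simp

lemma contrR_tmul_mul (p : H →ₗ[k] k) (t : H ⊗[k] H) (a b : H) :
    contrR p ((a ⊗ₜ b) * t) = a * contrR (p ∘ₗ LinearMap.mulLeft k b) t := by
  induction t with
  | zero => simp
  | add s t hs ht => simp only [map_add, mul_add, hs, ht]
  | tmul x y => simp

@[simp] lemma mulLeft_one_comp (p : H →ₗ[k] k) : p ∘ₗ LinearMap.mulLeft k 1 = p := by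
  ext; simp

@[simp] lemma mulRight_one_comp (p : H →ₗ[k] k) : p ∘ₗ LinearMap.mulRight k 1 = p := by
  ext; simp

lemma hitL_one (p : H →ₗ[k] k) : hitL p (1 : H) = p 1 • 1 := by
  simp [hitL_apply, Algebra.TensorProduct.one_def]

lemma hitR_one (p : H →ₗ[k] k) : hitR p (1 : H) = p 1 • 1 := by
  simp [hitR_apply, Algebra.TensorProduct.one_def]

/-- Sliding z from the first leg of Δ(Λ) to the second makes p ↦ p(Λ₁)Λ₂ equivariant up to S. This
is the Frobenius property of H. -/
lemma hitL_mulRight {Λ : H} (hΛ : ∀ z, Λ * z = counit (R := k) z • Λ) (p : H →ₗ[k] k) (z : H) :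
    hitL (p ∘ₗ LinearMap.mulRight k z) Λ = hitL p Λ * antipode k z := by
  have h := congrArg (contrL p) (comul_mul_tmul_one hΛ z)
  rwa [contrL_mul_tmul, contrL_mul_tmul, mul_one, mulRight_one_comp] at h

lemma hitL_mulLeft (hinv : IsInvolutiveHopf k H) {Λ : H}
    (hΛ : ∀ z, z * Λ = counit (R := k) z • Λ) (p : H →ₗ[k] k) (z : H) :
    hitL (p ∘ₗ LinearMap.mulLeft k z) Λ = antipode k z * hitL p Λ := by
  have h := congrArg (contrL p) (tmul_one_mul_comul hinv hΛ z)
  rwa [contrL_tmul_mul, contrL_tmul_mul, one_mul, mulLeft_one_comp] at h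

/-- The map p ↦ p(Λ₁)Λ₂ hits 1, hence everything by equivariance; a surjection between spaces of
equal dimension is injective. -/
lemma hitL_left_injective [FiniteDimensional k H] (hinv : IsInvolutiveHopf k H) {Λ : H}
    (hΛ : ∀ z, z * Λ = counit (R := k) z • Λ) {l : H →ₗ[k] k} (hl : hitL l Λ = 1)
    {p q : H →ₗ[k] k} (h : hitL p Λ = hitL q Λ) : p = q := by
  let F : (H →ₗ[k] k) →ₗ[k] H :=
    { toFun := fun p => hitL p Λ
      map_add' := fun p q => by simp [hitL_apply, contrL_add]
      map_smul' := fun c p => by simp [hitL_apply, contrL_smul] }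
  have hs : Function.Surjective F := fun z => ⟨l ∘ₗ LinearMap.mulLeft k (antipode k z), by
    change hitL _ Λ = z
    rw [hitL_mulLeft hinv hΛ, hl, mul_one, antipode_antipode hinv]⟩
  exact (LinearMap.injective_iff_surjective_of_finrank_eq_finrank
    (Subspace.dual_finrank_eq (K := k) (V := H))).2 hs h

/-- For each p, the functionals l * p and p(1)l both send Λ to p(1)1 under `hitL`, so injectivity
identifies them. Only the coalgebra and the unit are used, so this also applies to H^J. -/
lemma hitL_eq_smul_one {Λ : H} {l : H →ₗ[k] k} (hl : hitL l Λ = 1)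
    (hinj : ∀ p q : H →ₗ[k] k, hitL p Λ = hitL q Λ → p = q) (x : H) : hitL l x = l x • 1 := by
  apply eq_of_forall_apply_eq (k := k)
  intro p
  have : p ∘ₗ hitL l = p 1 • l := by
    apply hinj
    rw [← hitL_hitL, hl, hitL_one, hitL_apply (p 1 • l), contrL_smul, LinearMap.smul_apply,
      ← hitL_apply, hl]
  have h := LinearMap.congr_fun this x
  simp only [LinearMap.comp_apply] at h
  rw [h]
  simp [mul_comm]

/-- A cosemisimple Hopf algebra has a normalized two-sided integral in its dual. -/
lemma exists_dual_integral (hcos : IsCosemisimple k H) :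
    ∃ l : H →ₗ[k] k, l 1 = 1 ∧ (∀ x, hitL l x = l x • 1) ∧ ∀ x, hitR l x = l x • 1 := by
  have := isCosemisimple_iff.1 hcos
  have h1 : IsSubcoalgebra k (k ∙ (1 : H)) := by
    rw [isSubcoalgebra_iff]
    intro p x hx
    obtain ⟨c, rfl⟩ := Submodule.mem_span_singleton.1 hx
    simp only [map_smul, hitL_apply, hitR_apply, Bialgebra.comul_one,
      Algebra.TensorProduct.one_def, contrL_tmul, contrR_tmul]
    exact ⟨Submodule.smul_mem _ _ (Submodule.smul_mem _ _ (Submodule.mem_span_singleton_self _)),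
      Submodule.smul_mem _ _ (Submodule.smul_mem _ _ (Submodule.mem_span_singleton_self _))⟩
  -- The integral is the projection onto k·1 along a complementary subcoalgebra N; it is an integral
  -- because Δ(N) ⊆ N ⊗ N.
  obtain ⟨N, hN⟩ := this.toComplementedLattice.exists_isCompl (hitSubmodule _ h1)
  have hNs := isSubcoalgebra_restrictScalars N
  have hone : (1 : H) ∉ N.restrictScalars k := fun h => by
    have h0 : (1 : H) = 0 := (Submodule.disjoint_def.1 hN.disjoint) 1
      (Submodule.mem_span_singleton_self (R := k) (1 : H)) h
    have := congrArg (counit (R := k)) h0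
    simp at this
  obtain ⟨f, hf, hfN⟩ := Submodule.exists_le_ker_of_notMem hone
  let l : H →ₗ[k] k := (f 1)⁻¹ • f
  have hl1 : l 1 = 1 := by simp [l, inv_mul_cancel₀ hf]
  have hlN : ∀ x ∈ N, l x = 0 := fun x hx => by
    have : f x = 0 := hfN hx
    simp [l, this]
  have hdec : ∀ x : H, ∃ c : k, ∃ n ∈ N, x = c • 1 + n := fun x => by
    have hx : x ∈ hitSubmodule _ h1 ⊔ N := hN.sup_eq_top ▸ Submodule.mem_top
    obtain ⟨y, hy, n, hn, rfl⟩ := Submodule.mem_sup.1 hx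
    obtain ⟨c, rfl⟩ := Submodule.mem_span_singleton.1 (show y ∈ (k ∙ (1 : H)) from hy)
    exact ⟨c, n, hn, rfl⟩
  have hz : ∀ n ∈ N, hitL l n = 0 ∧ hitR l n = 0 := fun n hn => by
    obtain ⟨t, ht⟩ := hNs n hn
    rw [hitL_apply, hitR_apply, ← ht]
    clear ht
    induction t with
    | zero => simp
    | add s t hs ht => simp [map_add, hs, ht]
    | tmul a b =>
      have ha := hlN a a.2
      have hb := hlN b b.2
      simp [ha, hb]
  refine ⟨l, hl1, fun x => ?_, fun x => ?_⟩ <;> obtain ⟨c, n, hn, rfl⟩ := hdec x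
  · simp [(hz n hn).1, hitL_one, hl1, hlN n hn]
  · simp [(hz n hn).2, hitR_one, hl1, hlN n hn]

/-- In a cosemisimple involutive Hopf algebra, the regular character of the dual algebra is a
cocommutative two-sided integral. -/
lemma exists_integral [FiniteDimensional k H] (hcos : IsCosemisimple k H)
    (hinv : IsInvolutiveHopf k H) :
    ∃ (Λ : H) (l : H →ₗ[k] k), (∀ z, z * Λ = counit (R := k) z • Λ) ∧
      (∀ z, Λ * z = counit (R := k) z • Λ) ∧
      TensorProduct.comm k H H (comul (R := k) Λ) = comul (R := k) Λ ∧
      hitL l Λ = 1 ∧ l 1 = 1 := by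
  obtain ⟨l, hl1, hlL, hlR⟩ := exists_dual_integral hcos
  let T : (H →ₗ[k] k) →ₗ[k] (H →ₗ[k] H) :=
    { toFun := hitR
      map_add' := fun p q => by simp [hitR, contrR_add, LinearMap.add_comp]
      map_smul' := fun c p => by simp [hitR, contrR_smul, LinearMap.smul_comp] }
  -- The trace of the regular representation is a functional on the dual, hence an element of H by
  -- finite-dimensional biduality.
  let Λ : H := (Module.evalEquiv k H).symm (LinearMap.trace k H ∘ₗ T)
  have hΛ : ∀ p : H →ₗ[k] k, p Λ = LinearMap.trace k H (hitR p) := fun p =>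
    Module.apply_evalEquiv_symm_apply k H p _
  refine ⟨Λ, l, fun z => ?_, fun z => ?_, ?_, ?_, hl1⟩
  · apply eq_of_forall_apply_eq (k := k)
    intro p
    let r := ℛ k z
    -- This is x₁p(zx₂) = S(z₁)·`hitR p`(z₂x). Under the trace, S(z₁) moves around to the right of
    -- z₂, and z₂S(z₁) = ε(z) by involutivity.
    have h1 : hitR (p ∘ₗ LinearMap.mulLeft k z) = ∑ i ∈ r.index,
        LinearMap.mulLeft k (antipode k (r.left i)) * (hitR p * LinearMap.mulLeft k (r.right i)) := by
      ext x
      have h := congrArg (fun t => contrR p (t * comul x)) (sum_antipode_tmul_mul_comul r)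
      simp only [Finset.sum_mul, map_sum, contrR_tmul_mul, mul_assoc, ← Bialgebra.comul_mul] at h
      simpa [hitR_apply] using h.symm
    have h2 : ∑ i ∈ r.index, LinearMap.mulLeft k (r.right i) *
        LinearMap.mulLeft k (antipode k (r.left i)) = counit (R := k) z • (1 : Module.End k H) := by
      have h := mulAntipode_comm_comul hinv z
      rw [← r.eq] at h
      ext x
      simpa [← mul_assoc, ← Finset.sum_mul, Algebra.algebraMap_eq_smul_one] using
        congrArg (· * x) h
    have h3 : p (z * Λ) = (p ∘ₗ LinearMap.mulLeft k z) Λ := rfl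
    rw [h3, hΛ, h1, map_sum]
    simp_rw [LinearMap.trace_mul_comm k (LinearMap.mulLeft k (antipode k _)), mul_assoc]
    rw [← map_sum, ← Finset.mul_sum, h2]
    simp [hΛ]
  · apply eq_of_forall_apply_eq (k := k)
    intro p
    let r := ℛ k z
    -- On this side involutivity is spent here; after cycling the trace, the ordinary axiom S(z₁)z₂
    -- = ε(z) suffices.
    have h1 : hitR (p ∘ₗ LinearMap.mulRight k z) = ∑ i ∈ r.index,
        LinearMap.mulRight k (antipode k (r.left i)) *
          (hitR p * LinearMap.mulRight k (r.right i)) := by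
      ext x
      have h := congrArg (fun t => contrR p (comul x * t)) (sum_comul_mul_antipode_tmul hinv r)
      simp only [Finset.mul_sum, map_sum, contrR_mul_tmul, ← mul_assoc, ← Bialgebra.comul_mul] at h
      simpa [hitR_apply] using h.symm
    have h2 : ∑ i ∈ r.index, LinearMap.mulRight k (r.right i) *
        LinearMap.mulRight k (antipode k (r.left i)) = counit (R := k) z • (1 : Module.End k H) := by
      have h := antipodeMul_comul z (k := k)
      rw [← r.eq] at h
      ext x
      simpa [mul_assoc, ← Finset.mul_sum, Algebra.algebraMap_eq_smul_one] using
        congrArg (x * ·) h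
    have h3 : p (Λ * z) = (p ∘ₗ LinearMap.mulRight k z) Λ := rfl
    rw [h3, hΛ, h1, map_sum]
    simp_rw [LinearMap.trace_mul_comm k (LinearMap.mulRight k (antipode k _)), mul_assoc]
    rw [← map_sum, ← Finset.mul_sum, h2]
    simp [hΛ]
  · apply eq_of_contrL_eq
    intro q
    rw [contrL_comm, ← hitL_apply, ← hitR_apply]
    apply eq_of_forall_apply_eq (k := k)
    intro p
    -- Cocommutativity of Λ means (p * q)(Λ) = (q * p)(Λ), which is cyclicity of the trace.
    have hc : ∀ p q : H →ₗ[k] k, hitR (p ∘ₗ hitR q) = hitR p * hitR q := fun p q =>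
      LinearMap.ext fun x => (hitR_hitR p q x).symm
    rw [apply_hitL]
    change (p ∘ₗ hitR q) Λ = (q ∘ₗ hitR p) Λ
    rw [hΛ, hΛ, hc, hc, LinearMap.trace_mul_comm]
  · rw [hlL, hΛ]
    have : hitR l = l.smulRight (1 : H) := LinearMap.ext hlR
    rw [this, LinearMap.trace_smulRight, hl1, one_smul]

end Integrals

end HopfTwist

/-! ### Maschke's theorem for coalgebras with a separability form. -/

namespace HopfTwist

section Maschke

open Coalgebra HopfAlgebra

variable {k C : Type*} [Field k] [AddCommGroup C] [Module k C]

lemma map_eq_sum_coord [FiniteDimensional k C] {V : Type*} [AddCommGroup V] [Module k V] (f : C →ₗ[k] V) (x : C) :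
    f x = ∑ i, (Module.finBasis k C).coord i x • f (Module.finBasis k C i) := by
  conv_lhs => rw [← (Module.finBasis k C).sum_repr x]
  simp only [map_sum, map_smul, Module.Basis.coord_apply]

/-- Both sides evaluate the tensor in C ⊗ C* that corresponds to f: the canonical element lets f
pass from one factor to its transpose on the other. -/
lemma sum_apply_coord_comp [FiniteDimensional k C] {V : Type*} [AddCommGroup V] [Module k V] (f : C →ₗ[k] C)
    (g : C →ₗ[k] ((C →ₗ[k] k) →ₗ[k] V)) :
    ∑ i, g (Module.finBasis k C i) ((Module.finBasis k C).coord i ∘ₗ f) =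
      ∑ i, g (f (Module.finBasis k C i)) ((Module.finBasis k C).coord i) := by
  let b := Module.finBasis k C
  have h1 : ∀ i, b.coord i ∘ₗ f = ∑ j, b.coord i (f (b j)) • b.coord j := fun i => by
    apply b.ext
    intro j
    simp [Finsupp.single_apply]
  have h2 : ∀ i, f (b i) = ∑ j, b.coord j (f (b i)) • b j := fun i => by
    simp [b.sum_repr]
  change ∑ i, g (b i) (b.coord i ∘ₗ f) = ∑ i, g (f (b i)) (b.coord i)
  conv_lhs => enter [2, i]; rw [h1]
  conv_rhs => enter [2, i]; rw [h2]
  simp only [map_sum, map_smul, LinearMap.sum_apply, LinearMap.smul_apply]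
  rw [Finset.sum_comm]

variable [Coalgebra k C]

variable (k C) in
/-- `hitL` as a linear map. -/
noncomputable def hitLLinear : (C →ₗ[k] k) →ₗ[k] Module.End k C where
  toFun := hitL
  map_add' p q := by simp [hitL, contrL_add, LinearMap.add_comp]
  map_smul' c p := by simp [hitL, contrL_smul, LinearMap.smul_comp]

variable (k C) in
/-- `hitR` as a linear map. -/
noncomputable def hitRLinear : (C →ₗ[k] k) →ₗ[k] Module.End k C where
  toFun := hitR
  map_add' p q := by simp [hitR, contrR_add, LinearMap.add_comp]
  map_smul' c p := by simp [hitR, contrR_smul, LinearMap.smul_comp]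

/-- A separability form on a coalgebra: `β(x, y)` with `x₁ β(x₂, y) = β(x, y₁) y₂` and
`β(x₁, x₂) = ε(x)`. -/
structure IsSeparabilityForm (β : C →ₗ[k] C →ₗ[k] k) : Prop where
  hit : ∀ (p : C →ₗ[k] k) (x y : C), β (hitL p x) y = β x (hitR p y)
  lift_comul : ∀ x, TensorProduct.lift β (Coalgebra.comul x) = Coalgebra.counit (R := k) x

variable {β : C →ₗ[k] C →ₗ[k] k}

lemma hitR_mul_hitR (p q : C →ₗ[k] k) :
    (hitR p * hitR q : Module.End k C) = hitR (p ∘ₗ hitR q) :=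
  LinearMap.ext fun x => hitR_hitR p q x

lemma hitL_mul_hitL (p q : C →ₗ[k] k) :
    (hitL p * hitL q : Module.End k C) = hitL (q ∘ₗ hitR p) :=
  LinearMap.ext fun x => by rw [← comp_hitL]; exact hitL_hitL p q x

lemma hitL_mul_hitR (p q : C →ₗ[k] k) :
    (hitL p * hitR q : Module.End k C) = hitR q * hitL p :=
  LinearMap.ext fun x => hitL_hitR p q x

/-- In convolution terms, y ↦ β(·, y) is linear over the dual algebra. With `sum_apply_coord_comp`
this makes ∑ β(·, bᵢ) ⊗ bⁱ a Casimir element, so the averages commute with the action. -/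
lemma IsSeparabilityForm.flip_hitR (hβ : IsSeparabilityForm β) (p : C →ₗ[k] k) (y : C) :
    β.flip (hitR p y) = p ∘ₗ hitR (β.flip y) := by
  rw [← comp_hitL]
  exact LinearMap.ext fun x => (hβ.hit p x y).symm

variable [FiniteDimensional k C]

variable (β) in
/-- The average of an endomorphism over the right action of the dual. -/
noncomputable def averageR (P : Module.End k C) : Module.End k C :=
  ∑ i, hitR (β.flip (Module.finBasis k C i)) * (P * hitR ((Module.finBasis k C).coord i))

variable (β) in
/-- The average of an endomorphism over the left action of the dual. -/
noncomputable def averageL (P : Module.End k C) : Module.End k C :=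
  ∑ i, hitL ((Module.finBasis k C).coord i) * (P * hitL (β.flip (Module.finBasis k C i)))

lemma IsSeparabilityForm.averageR_comm (hβ : IsSeparabilityForm β) (P : Module.End k C)
    (p : C →ₗ[k] k) : averageR β P * hitR p = hitR p * averageR β P := by
  let g : C →ₗ[k] ((C →ₗ[k] k) →ₗ[k] Module.End k C) :=
    ((LinearMap.mul k (Module.End k C)).compl₂ (LinearMap.mulLeft k P ∘ₗ hitRLinear k C)) ∘ₗ
      hitRLinear k C ∘ₗ β.flip
  have h := sum_apply_coord_comp (hitR p) g
  have hg : ∀ x q, g x q = hitR (β.flip x) * (P * hitR q) := fun _ _ => rfl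
  simp only [hg, hβ.flip_hitR, ← hitR_mul_hitR, mul_assoc] at h
  simp only [averageR, Finset.sum_mul, Finset.mul_sum, mul_assoc, h]

lemma IsSeparabilityForm.averageL_comm (hβ : IsSeparabilityForm β) (P : Module.End k C)
    (p : C →ₗ[k] k) : averageL β P * hitL p = hitL p * averageL β P := by
  let g : C →ₗ[k] ((C →ₗ[k] k) →ₗ[k] Module.End k C) :=
    ((LinearMap.mul k (Module.End k C)).flip.compl₁₂
      (LinearMap.mulLeft k P ∘ₗ hitLLinear k C ∘ₗ β.flip) (hitLLinear k C))
  have h := sum_apply_coord_comp (hitR p) g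
  have hg : ∀ x q, g x q = hitL q * (P * hitL (β.flip x)) := fun _ _ => rfl
  simp only [hg, hβ.flip_hitR, ← hitL_mul_hitL, mul_assoc] at h
  simp only [averageL, Finset.sum_mul, Finset.mul_sum, mul_assoc, h]

/-- Since the left and right actions commute, averaging on the left does not destroy right
equivariance already achieved. -/
lemma averageL_comm_hitR {P : Module.End k C} (p : C →ₗ[k] k)
    (hP : P * hitR p = hitR p * P) : averageL β P * hitR p = hitR p * averageL β P := by
  simp only [averageL, Finset.sum_mul, Finset.mul_sum]
  refine Finset.sum_congr rfl fun i _ => ?_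
  rw [mul_assoc, mul_assoc, hitL_mul_hitR, ← mul_assoc P, hP, ← mul_assoc (hitR p) (hitL _),
    ← hitL_mul_hitR]
  simp only [mul_assoc]

/-- The Casimir element multiplies to the unit ε of the dual algebra, which is why averaging keeps
the identity on a subcoalgebra. -/
lemma IsSeparabilityForm.sum_flip_comp (hβ : IsSeparabilityForm β) :
    ∑ i, β.flip (Module.finBasis k C i) ∘ₗ hitR ((Module.finBasis k C).coord i) =
      (Coalgebra.counit : C →ₗ[k] k) := by
  ext x
  rw [← hβ.lift_comul x]
  simp only [LinearMap.sum_apply, LinearMap.comp_apply, hitR_apply]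
  induction Coalgebra.comul (R := k) x with
  | zero => simp
  | add s t hs ht => simp only [map_add, Finset.sum_add_distrib, hs, ht]
  | tmul a b =>
    rw [TensorProduct.lift.tmul, map_eq_sum_coord (β a) b]
    simp

lemma IsSeparabilityForm.averageR_apply (hβ : IsSeparabilityForm β) {D : Submodule k C}
    (hD : IsSubcoalgebra k D) {P : Module.End k C} (hP : ∀ x ∈ D, P x = x) (x : C) (hx : x ∈ D) :
    averageR β P x = x := by
  have h : averageR β P x = ∑ i, hitR (β.flip (Module.finBasis k C i) ∘ₗ
      hitR ((Module.finBasis k C).coord i)) x := by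
    simp only [averageR, LinearMap.sum_apply]
    refine Finset.sum_congr rfl fun i _ => ?_
    rw [Module.End.mul_apply, Module.End.mul_apply, hP _ (isSubcoalgebra_iff.1 hD _ x hx).2,
      hitR_hitR]
  rw [h]
  have := congrArg (fun p => hitRLinear k C p x) hβ.sum_flip_comp
  simp only [map_sum, LinearMap.sum_apply] at this
  exact this.trans (LinearMap.congr_fun hitR_counit x)

lemma IsSeparabilityForm.averageL_apply (hβ : IsSeparabilityForm β) {D : Submodule k C}
    (hD : IsSubcoalgebra k D) {P : Module.End k C} (hP : ∀ x ∈ D, P x = x) (x : C) (hx : x ∈ D) :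
    averageL β P x = x := by
  have h : averageL β P x = ∑ i, hitL (β.flip (Module.finBasis k C i) ∘ₗ
      hitR ((Module.finBasis k C).coord i)) x := by
    simp only [averageL, LinearMap.sum_apply]
    refine Finset.sum_congr rfl fun i _ => ?_
    rw [Module.End.mul_apply, Module.End.mul_apply, hP _ (isSubcoalgebra_iff.1 hD _ x hx).1,
      hitL_hitL, comp_hitL]
  rw [h]
  have := congrArg (fun p => hitLLinear k C p x) hβ.sum_flip_comp
  simp only [map_sum, LinearMap.sum_apply] at this
  exact this.trans (LinearMap.congr_fun hitL_counit x)

lemma averageR_mem {D : Submodule k C} (hD : IsSubcoalgebra k D) {P : Module.End k C}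
    (hP : ∀ x, P x ∈ D) (x : C) : averageR β P x ∈ D := by
  simp only [averageR, LinearMap.sum_apply]
  exact D.sum_mem fun i _ => (isSubcoalgebra_iff.1 hD _ _ (hP _)).2

lemma averageL_mem {D : Submodule k C} (hD : IsSubcoalgebra k D) {P : Module.End k C}
    (hP : ∀ x, P x ∈ D) (x : C) : averageL β P x ∈ D := by
  simp only [averageL, LinearMap.sum_apply]
  exact D.sum_mem fun i _ => (isSubcoalgebra_iff.1 hD _ _ (hP _)).1

/-- A finite-dimensional coseparable coalgebra is cosemisimple. -/
theorem IsSeparabilityForm.isCosemisimple (hβ : IsSeparabilityForm β) : IsCosemisimple k C := by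
  rw [isCosemisimple_iff, isSemisimpleModule_iff]
  constructor
  intro N
  let D := N.restrictScalars k
  have hD : IsSubcoalgebra k D := isSubcoalgebra_restrictScalars N
  obtain ⟨π, hπ⟩ := D.subtype.exists_leftInverse_of_injective D.ker_subtype
  -- Averaging a linear projection on both sides gives a bi-equivariant projection onto D, whose
  -- kernel is a complementary subcoalgebra.
  let P : Module.End k C := averageL β (averageR β (D.subtype ∘ₗ π))
  have hP1 : ∀ x ∈ D, P x = x := hβ.averageL_apply hD (hβ.averageR_apply hD fun x hx =>
    congrArg D.subtype (LinearMap.congr_fun hπ ⟨x, hx⟩))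
  have hP2 : ∀ x, P x ∈ D := averageL_mem hD (averageR_mem hD fun x => (π x).2)
  have hPL : ∀ p, P * hitL p = hitL p * P := hβ.averageL_comm _
  have hPR : ∀ p, P * hitR p = hitR p * P := fun p =>
    averageL_comm_hitR p (hβ.averageR_comm _ p)
  have hK : IsSubcoalgebra k (LinearMap.ker P) := isSubcoalgebra_iff.2 fun p x hx => by
    rw [LinearMap.mem_ker] at hx
    refine ⟨?_, ?_⟩ <;> rw [LinearMap.mem_ker]
    · rw [← Module.End.mul_apply, hPL, Module.End.mul_apply, hx, map_zero]
    · rw [← Module.End.mul_apply, hPR, Module.End.mul_apply, hx, map_zero]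
  refine ⟨hitSubmodule _ hK, IsCompl.of_eq ?_ ?_⟩
  · rw [eq_bot_iff]
    rintro x ⟨hx1, hx2⟩
    have : P x = 0 := hx2
    rw [hP1 x hx1] at this
    exact (Submodule.mem_bot _).2 this
  · rw [eq_top_iff]
    intro x _
    refine Submodule.mem_sup.2 ⟨P x, hP2 x, x - P x, ?_, by simp⟩
    change P (x - P x) = 0
    rw [map_sub, hP1 _ (hP2 x), sub_self]

variable {H : Type*} [Ring H] [HopfAlgebra k H] [FiniteDimensional k H]

/-- A finite-dimensional unimodular involutive Hopf algebra whose dual has a normalized integral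
is cosemisimple. -/
theorem isCosemisimple_of_integral (hinv : IsInvolutiveHopf k H) {Λ : H}
    (hΛ : ∀ z, z * Λ = counit (R := k) z • Λ) {l : H →ₗ[k] k} (hl : hitL l Λ = 1)
    (hl1 : l 1 = 1) : IsCosemisimple k H := by
  -- The functional β(x, ·) is the unique preimage of x under the bijection p ↦ p(Λ₁)Λ₂. The
  -- invariance of β is therefore checked on Λ, and its normalization is l(S(x₁)x₂) = ε(x)l(1).
  let β : H →ₗ[k] H →ₗ[k] k := (LinearMap.mul k H ∘ₗ antipode k).compr₂ l
  have hβ : ∀ x y, β x y = l (antipode k x * y) := fun _ _ => rfl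
  have hβ' : ∀ x, hitL (β x) Λ = x := fun x => by
    have : β x = l ∘ₗ LinearMap.mulLeft k (antipode k x) := rfl
    rw [this, hitL_mulLeft hinv hΛ, hl, mul_one, antipode_antipode hinv]
  refine IsSeparabilityForm.isCosemisimple (β := β) ⟨fun p x y => ?_, fun x => ?_⟩
  · have : β (hitL p x) = β x ∘ₗ hitR p := by
      apply hitL_left_injective hinv hΛ hl
      rw [hβ', ← comp_hitL, ← hitL_hitL, hβ']
    exact LinearMap.congr_fun this y
  · have : TensorProduct.lift β = l ∘ₗ antipodeMul k H := TensorProduct.ext' fun _ _ => rfl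
    rw [this, LinearMap.comp_apply, antipodeMul_comul, Algebra.algebraMap_eq_smul_one, map_smul,
      hl1, smul_eq_mul, mul_one]

end Maschke

end HopfTwist

/-! ### The integral under twisting, and the triviality of u. -/

namespace HopfTwist

section Twisting

open Coalgebra HopfAlgebra

variable {k H : Type*} [Field k] [Ring H] [HopfAlgebra k H]

/-- Slide the first leg of t across Δ(Λ). For t = J the result is Q, and for the flip of J it is
S(Q). -/
lemma mul_eq_of_right_integral {Λ : H} (hΛ : ∀ z, Λ * z = counit (R := k) z • Λ)
    (t : H ⊗[k] H) : comul (R := k) Λ * t = comul (R := k) Λ * (1 ⊗ₜ antipodeMul k H t) := by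
  induction t with
  | zero => simp
  | add s t hs ht => simp only [map_add, mul_add, TensorProduct.tmul_add, hs, ht]
  | tmul a b =>
    have h : (a ⊗ₜ[k] b : H ⊗[k] H) = (a ⊗ₜ 1) * (1 ⊗ₜ b) := by simp
    rw [h, ← mul_assoc, comul_mul_tmul_one hΛ, mul_assoc]
    simp

lemma mul_eq_of_left_integral (hinv : IsInvolutiveHopf k H) {Λ : H}
    (hΛ : ∀ z, z * Λ = counit (R := k) z • Λ) (t : H ⊗[k] H) :
    t * comul (R := k) Λ = (1 ⊗ₜ antipode k (mulAntipode k H t)) * comul (R := k) Λ := by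
  induction t with
  | zero => simp
  | add s t hs ht => simp only [map_add, add_mul, TensorProduct.tmul_add, hs, ht]
  | tmul a b =>
    have h : (a ⊗ₜ[k] b : H ⊗[k] H) = (1 ⊗ₜ b) * (a ⊗ₜ 1) := by simp
    rw [h, mul_assoc, tmul_one_mul_comul hinv hΛ, ← mul_assoc]
    simp [antipode_mul_antidistrib, antipode_antipode hinv]

variable (k H) in
/-- The cyclic rotation `x ⊗ y ⊗ z ↦ y ⊗ z ⊗ x`. -/
noncomputable def rotate : H ⊗[k] (H ⊗[k] H) →ₐ[k] H ⊗[k] (H ⊗[k] H) :=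
  (Algebra.TensorProduct.assoc k k k H H H).toAlgHom.comp
    (Algebra.TensorProduct.comm k H (H ⊗[k] H)).toAlgHom

@[simp] lemma rotate_tmul (x y z : H) : rotate k H (x ⊗ₜ (y ⊗ₜ z)) = y ⊗ₜ (z ⊗ₜ x) := rfl

lemma rotate_comulRight (t : H ⊗[k] H) :
    rotate k H (comulRight k H t) = comulLeft k H (TensorProduct.comm k H H t) := by
  induction t with
  | zero => simp
  | add s t hs ht => simp only [map_add, hs, ht]
  | tmul a b => rfl

lemma rotate_inclRight (t : H ⊗[k] H) : rotate k H (inclRight k H t) = inclLeft k H t := by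
  induction t with
  | zero => simp
  | add s t hs ht => simp only [map_add, hs, ht]
  | tmul a b => rfl

lemma rotate_rotate_comulLeft (t : H ⊗[k] H) : rotate k H (rotate k H (comulLeft k H t)) =
    comulRight k H (TensorProduct.comm k H H t) := by
  induction t with
  | zero => simp
  | add s t hs ht => simp only [map_add, hs, ht]
  | tmul a b =>
    rw [comulLeft_tmul, TensorProduct.comm_tmul, comulRight_tmul]
    induction comul (R := k) a with
    | zero => simp
    | add s t hs ht => simp only [map_add, TensorProduct.add_tmul, TensorProduct.tmul_add, hs, ht]
    | tmul x y => simp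

lemma rotate_rotate_inclLeft (t : H ⊗[k] H) :
    rotate k H (rotate k H (inclLeft k H t)) = inclRight k H t := by
  induction t with
  | zero => simp
  | add s t hs ht => simp only [map_add, hs, ht]
  | tmul a b => rfl

/-- `x ⊗ w ↦ p(x) w`. -/
noncomputable def contrFirst (p : H →ₗ[k] k) : H ⊗[k] (H ⊗[k] H) →ₗ[k] H ⊗[k] H :=
  (TensorProduct.lid k (H ⊗[k] H)).toLinearMap ∘ₗ p.rTensor (H ⊗[k] H)

lemma contrFirst_comulRight_mul (p : H →ₗ[k] k) (t X : H ⊗[k] H) :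
    contrFirst p (comulRight k H t * inclRight k H X) = comul (contrL p t) * X := by
  induction t with
  | zero => simp
  | add s t hs ht => simp only [map_add, add_mul, hs, ht]
  | tmul a b => simp [comulRight_tmul, inclRight_apply, contrFirst]

variable (J : HopfTwist k H)

lemma coe_Q : (J.Q : H) = antipodeMul k H J.unit := rfl

lemma coe_Q_inv : (↑J.Q⁻¹ : H) = mulAntipode k H ↑J.unit⁻¹ := rfl

lemma comul_integral_mul {Λ : H} (hΛ : ∀ z, Λ * z = counit (R := k) z • Λ) :
    comul (R := k) Λ * (J.unit : H ⊗[k] H) = comul (R := k) Λ * (1 ⊗ₜ (J.Q : H)) := by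
  rw [mul_eq_of_right_integral hΛ, coe_Q]

lemma comm_comul_integral_mul (hinv : IsInvolutiveHopf k H) {Λ : H}
    (hΛ : ∀ z, Λ * z = counit (R := k) z • Λ)
    (hcomm : TensorProduct.comm k H H (comul (R := k) Λ) = comul (R := k) Λ) :
    TensorProduct.comm k H H (comul (R := k) Λ * (J.unit : H ⊗[k] H)) =
      comul (R := k) Λ * (J.unit : H ⊗[k] H) * (1 ⊗ₜ J.u) := by
  have hm : TensorProduct.comm k H H (comul (R := k) Λ * (J.unit : H ⊗[k] H)) =
      TensorProduct.comm k H H (comul (R := k) Λ) * TensorProduct.comm k H H J.unit :=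
    map_mul (Algebra.TensorProduct.comm k H H) _ _
  rw [hm, hcomm, mul_eq_of_right_integral hΛ, ← antipode_antipodeMul hinv, ← coe_Q,
    comul_integral_mul J hΛ, mul_assoc]
  congr 1
  simp [u]

/-- `u_J` satisfies `Δ(u_J) J = J (u_J ⊗ u_J)`. -/
lemma comul_u_mul (hinv : IsInvolutiveHopf k H) {Λ : H}
    (hΛ : ∀ z, Λ * z = counit (R := k) z • Λ)
    (hcomm : TensorProduct.comm k H H (comul (R := k) Λ) = comul (R := k) Λ)
    {l : H →ₗ[k] k} (hl : hitL l Λ = 1) :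
    comul (R := k) J.u * (J.unit : H ⊗[k] H) =
      (J.unit : H ⊗[k] H) * (J.u ⊗ₜ[k] J.u) := by
  set t := comul (R := k) Λ * (J.unit : H ⊗[k] H) with ht
  have hct : TensorProduct.comm k H H t = t * (1 ⊗ₜ J.u) :=
    J.comm_comul_integral_mul hinv hΛ hcomm
  -- With W the iterated twisted coproduct of Λ, up to left multiplication by an invertible element,
  -- the twist equation and coassociativity give two expressions for W.
  have hW : comulLeft k H t * inclLeft k H J.unit = comulRight k H t * inclRight k H J.unit := by
    rw [ht, map_mul, map_mul, mul_assoc, mul_assoc, J.twist_eq]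
    congr 1
    exact coassoc_apply Λ
  clear_value t
  have e1 : comulLeft k H (1 ⊗ₜ J.u) = 1 ⊗ₜ (1 ⊗ₜ J.u) := by
    simp [comulLeft_tmul, Algebra.TensorProduct.one_def]
  have e2 : (1 ⊗ₜ (1 ⊗ₜ J.u)) * inclLeft k H (J.unit : H ⊗[k] H) =
      inclLeft k H (J.unit : H ⊗[k] H) * (1 ⊗ₜ (1 ⊗ₜ J.u)) := by
    induction (J.unit : H ⊗[k] H) with
    | zero => simp
    | add s t hs ht => simp only [map_add, mul_add, add_mul, hs, ht]
    | tmul a b => simp [inclLeft_tmul]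
  -- One rotation moves a single leg past the other two, which is a flip of t and costs one factor
  -- u.
  have h1 : rotate k H (comulRight k H t * inclRight k H J.unit) =
      comulRight k H t * inclRight k H J.unit * (1 ⊗ₜ (1 ⊗ₜ J.u)) := by
    rw [map_mul, rotate_comulRight, rotate_inclRight, hct, map_mul, e1, mul_assoc, e2, ← mul_assoc,
      hW]
  -- Two rotations computed in two ways: as one flip of t, which inserts Δ(u) before J, and as `h1`
  -- applied twice, which puts u ⊗ u after J.
  have h2 : comulRight k H t * comulRight k H (1 ⊗ₜ J.u) * inclRight k H J.unit =
      comulRight k H t * inclRight k H J.unit * (1 ⊗ₜ (1 ⊗ₜ J.u)) * (1 ⊗ₜ (J.u ⊗ₜ 1)) := by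
    have h := congrArg (rotate k H) h1
    rw [map_mul (rotate k H) _ (1 ⊗ₜ (1 ⊗ₜ J.u)), h1, rotate_tmul] at h
    rw [← h, ← h1, ← hW, map_mul (rotate k H), map_mul (rotate k H), rotate_rotate_comulLeft, rotate_rotate_inclLeft, hct,
      map_mul]
  have e3 : comulRight k H (1 ⊗ₜ J.u) = inclRight k H (comul (R := k) J.u) := rfl
  have e4 : (1 ⊗ₜ (1 ⊗ₜ J.u)) * (1 ⊗ₜ (J.u ⊗ₜ 1)) = inclRight k H (J.u ⊗ₜ[k] J.u) := by
    simp [inclRight_apply]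
  rw [e3, mul_assoc, mul_assoc, mul_assoc, e4, ← map_mul, ← map_mul] at h2
  -- This functional contracts the first leg of t to 1: the twist by S(Q⁻¹) contributes S²(Q⁻¹) =
  -- Q⁻¹, cancelling the Q in Δ(Λ)(1 ⊗ Q). It removes t from both sides.
  have h3 := congrArg (contrFirst (l ∘ₗ LinearMap.mulRight k (antipode k (↑J.Q⁻¹ : H)))) h2
  have h4 : contrL (l ∘ₗ LinearMap.mulRight k (antipode k (↑J.Q⁻¹ : H))) t = 1 := by
    rw [ht, comul_integral_mul J hΛ, contrL_mul_tmul, mulRight_one_comp, ← hitL_apply,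
      hitL_mulRight hΛ, hl, antipode_antipode hinv, one_mul, Units.inv_mul]
  rwa [contrFirst_comulRight_mul, contrFirst_comulRight_mul, h4, Bialgebra.comul_one, one_mul,
    one_mul] at h3

lemma twistedComul_integral (hinv : IsInvolutiveHopf k H) {Λ : H}
    (hΛl : ∀ z, z * Λ = counit (R := k) z • Λ) (hΛr : ∀ z, Λ * z = counit (R := k) z • Λ) :
    J.twistedComul Λ =
      (1 ⊗ₜ antipode k (↑J.Q⁻¹ : H)) * (comul (R := k) Λ * (1 ⊗ₜ (J.Q : H))) := by
  rw [twistedComul_apply, comul_integral_mul J hΛr, ← mul_assoc,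
    mul_eq_of_left_integral hinv hΛl, ← coe_Q_inv, mul_assoc]

/-- Twisting changes p ↦ p(Λ₁)Λ₂ only by invertible factors on the left and right, so its
injectivity carries over to H^J. -/
lemma hitL_toTwisted_integral (hinv : IsInvolutiveHopf k H) {Λ : H}
    (hΛl : ∀ z, z * Λ = counit (R := k) z • Λ) (hΛr : ∀ z, Λ * z = counit (R := k) z • Λ)
    (p : J.Twisted →ₗ[k] k) :
    hitL p (J.toTwisted Λ) =
      J.toTwisted (antipode k (↑J.Q⁻¹ : H) *
        (hitL (p ∘ₗ J.toTwisted.toLinearMap) Λ * J.Q)) := by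
  change contrL (p ∘ₗ J.toTwisted.toLinearMap) (J.twistedComul Λ) = _
  rw [twistedComul_integral J hinv hΛl hΛr, contrL_tmul_mul, mulLeft_one_comp, contrL_mul_tmul,
    mulRight_one_comp]
  rfl

lemma u_eq_one [FiniteDimensional k H] (hinv : IsInvolutiveHopf k H) {Λ : H}
    (hΛl : ∀ z, z * Λ = counit (R := k) z • Λ) (hΛr : ∀ z, Λ * z = counit (R := k) z • Λ)
    (hcomm : TensorProduct.comm k H H (comul (R := k) Λ) = comul (R := k) Λ)
    {l : H →ₗ[k] k} (hl : hitL l Λ = 1) (hl1 : l 1 = 1) : J.u = 1 := by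
  have hS : antipode k (J.Q : H) * antipode k (↑J.Q⁻¹ : H) = 1 := by
    rw [← antipode_mul_antidistrib, Units.inv_mul, antipode_one]
  have hS' : antipode k (↑J.Q⁻¹ : H) * antipode k (J.Q : H) = 1 := by
    rw [← antipode_mul_antidistrib, Units.mul_inv, antipode_one]
  -- This x is the inverse of u. Translating l by it makes the twisted contraction of Λ equal to 1,
  -- and gives l'(u) = l(ux) = l(1).
  let x : H := antipode k (↑J.Q⁻¹ : H) * J.Q
  let l' : J.Twisted →ₗ[k] k := l ∘ₗ LinearMap.mulRight k x ∘ₗ J.toTwisted.symm.toLinearMap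
  have hcomp : l' ∘ₗ J.toTwisted.toLinearMap = l ∘ₗ LinearMap.mulRight k x := rfl
  have hl' : hitL l' (J.toTwisted Λ) = 1 := by
    rw [hitL_toTwisted_integral J hinv hΛl hΛr, hcomp, hitL_mulRight hΛr, hl, one_mul,
      antipode_mul_antidistrib, antipode_antipode hinv, mul_assoc, Units.inv_mul, mul_one, hS',
      map_one]
  have hinj : ∀ p q : J.Twisted →ₗ[k] k, hitL p (J.toTwisted Λ) = hitL q (J.toTwisted Λ) →
      p = q := by
    intro p q h
    rw [hitL_toTwisted_integral J hinv hΛl hΛr, hitL_toTwisted_integral J hinv hΛl hΛr] at h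
    have h2 := congrArg (fun y => antipode k (J.Q : H) * y * ↑J.Q⁻¹) (J.toTwisted.injective h)
    simp only [← mul_assoc, hS, one_mul] at h2
    simp only [mul_assoc, Units.mul_inv, mul_one] at h2
    have h3 := hitL_left_injective hinv hΛl hl h2
    ext y
    obtain ⟨y, rfl⟩ := J.toTwisted.surjective y
    exact LinearMap.congr_fun h3 y
  have h1 := hitL_eq_smul_one hl' hinj (J.toTwisted J.u)
  -- By `comul_u_mul`, Δ^J(u) = u ⊗ u, so the contraction returns a multiple of u; `h1` says that it
  -- is the same multiple of 1.
  have h2 : hitL l' (J.toTwisted J.u) = J.toTwisted (l' (J.toTwisted J.u) • J.u) := by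
    change contrL (l' ∘ₗ J.toTwisted.toLinearMap) (J.twistedComul J.u) = _
    rw [twistedComul_apply, J.comul_u_mul hinv hΛr hcomm hl, ← mul_assoc, Units.inv_mul, one_mul,
      contrL_tmul]
    rfl
  have h3 : l' (J.toTwisted J.u) = 1 := by
    change l (↑J.Q⁻¹ * antipode k (J.Q : H) * (antipode k (↑J.Q⁻¹ : H) * J.Q)) = 1
    rw [mul_assoc, ← mul_assoc (antipode k _), hS, one_mul, Units.inv_mul, hl1]
  rw [h2, h3, one_smul, one_smul] at h1
  exact J.toTwisted.injective (h1.trans (map_one _).symm)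

end Twisting

end HopfTwist

theorem mainTheorem7 {k H : Type*} [Field k] [IsAlgClosed k] [Ring H] [HopfAlgebra k H]
    [FiniteDimensional k H] (hcos : IsCosemisimple k H) (hinv : IsInvolutiveHopf k H)
    (J : HopfTwist k H) :
    J.u = 1 ∧
      HopfAlgebra.antipode k (J.Q : H) = (J.Q : H) ∧
      FiniteDimensional k J.Twisted ∧ IsCosemisimple k J.Twisted ∧
      IsInvolutiveHopf k J.Twisted := by
  obtain ⟨Λ, l, hΛl, hΛr, hcomm, hl, hl1⟩ := HopfTwist.exists_integral hcos hinv
  have hu := J.u_eq_one hinv hΛl hΛr hcomm hl hl1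
  have hQ : HopfAlgebra.antipode k (J.Q : H) = J.Q := by
    have h := congrArg ((J.Q : H) * ·) hu
    simpa [HopfTwist.u] using h
  have hQ' : HopfAlgebra.antipode k (↑J.Q⁻¹ : H) = ↑J.Q⁻¹ := by
    refine left_inv_eq_right_inv (a := (J.Q : H)) ?_ (Units.mul_inv _)
    conv_lhs => enter [2]; rw [← hQ]
    rw [← HopfAlgebra.antipode_mul_antidistrib, Units.mul_inv, HopfAlgebra.antipode_one]
  have hfin : FiniteDimensional k J.Twisted := inferInstanceAs (FiniteDimensional k H)
  have hinvT : IsInvolutiveHopf k J.Twisted := by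
    refine LinearMap.ext fun x => ?_
    obtain ⟨h, rfl⟩ := J.toTwisted.surjective x
    rw [LinearMap.comp_apply, J.antipode_toTwisted, J.antipode_toTwisted, LinearMap.id_apply]
    congr 1
    simp [HopfAlgebra.antipode_mul_antidistrib, HopfTwist.antipode_antipode hinv, hQ, hQ',
      mul_assoc]
  refine ⟨hu, hQ, hfin, ?_, hinvT⟩
  have hΛT : ∀ z : J.Twisted, z * J.toTwisted Λ = Coalgebra.counit (R := k) z • J.toTwisted Λ := by
    intro z
    obtain ⟨z, rfl⟩ := J.toTwisted.surjective z
    rw [← map_mul, hΛl, map_smul, J.counit_toTwisted]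
  -- Now that S(Q) = Q, no translate is needed: the untwisted l contracts Λ in H^J to S(Q⁻¹)Q = 1.
  refine HopfTwist.isCosemisimple_of_integral hinvT hΛT (l := l ∘ₗ J.toTwisted.symm.toLinearMap) ?_ hl1
  have hcomp : (l ∘ₗ J.toTwisted.symm.toLinearMap) ∘ₗ J.toTwisted.toLinearMap = l := rfl
  rw [J.hitL_toTwisted_integral hinv hΛl hΛr, hcomp, hl, one_mul, hQ', Units.inv_mul, map_one]
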